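/- Let $\mathfrak h$ be a finite-dimensional complex Hilbert space and let $V\subset\mathbb R^d$ be a locally finite lattice (a discrete subgroup), positively generated by a set $S\subset V$: every $v\in V$ is a finite sum of elements of $S$. Let $L_s$, $s\in S$, be operators on $\mathfrak h$ with $\sum_{s\in S}L_s^*L_s=\mathrm{Id}$, and for $u\in\mathbb R^d$ put $$\mathfrak L(X)=\sum_{s\in S}L_sXL_s^*,\qquad \mathfrak L_u(X)=\sum_{s\in S}e^{\langle u,s\rangle}L_sXL_s^* ,$$ where, if $S$ is infinite, it is assumed that the series defining $\mathfrak L_u$ converges for every $u\in\mathbb R^d$, i.e. $\sum_{s}e^{\langle u,s\rangle}\|L_s\|^2<\infty$ (this is automatic when $S$ is finite). Let $\lambda_u$ be the spectral radius of $\mathfrak L_u$. Let $\rho=\sum_{i\in V}\rho(i)\otimes|i\rangle\langle i|$ be a state on $\mathfrak h\otimes\mathbb C^V$ (so $\rho(i)\ge 0$ and $\sum_i\mathrm{Tr}\,\rho(i)=1$), and let $(X_p)_{p\in\mathbb N}$ be the position process of the open quantum random walk with initial state $\rho$, that is, the coordinate process on $V^{\mathbb N}$ under the unique probability measure $\mathbb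 P_\rho$ such that $$\mathbb P_\rho(X_0=i_0,\dots,X_p=i_p)=\mathrm{Tr}\big(L_{s_p}\cdots L_{s_1}\rho(i_0)L_{s_1}^*\cdots L_{s_p}^*\big)$$ if $s_k:=i_k-i_{k-1}\in S$ for $k=1,\dots,p$, and $=0$ otherwise. Assume that $\mathfrak L$ is irreducible: the only orthogonal projections $P$ on $\mathfrak h$ with $\mathfrak L(P\mathcal B(\mathfrak h)P)\subset P\mathcal B(\mathfrak h)P$ are $0$ and $\mathrm{Id}$. Then $\mathfrak L$ has a unique invariant state $\rho^{\mathrm{inv}}$; the functions $u\mapsto\lambda_u$ and $u\mapsto\log\lambda_u$ are of class $C^2$ near $0$; the Hessian matrix $C$ of $u\mapsto\log\lambda_u$ at $0$ is positive semidefinite and satisfies $$\langle u,Cu\rangle=\lambda_u''-(\lambda_u')^2\quad(u\in\mathbb R^d),\qquad \lambda_u'=\tfrac{d}{dt}\Big|_{t=0}\lambda_{tu},\quad \lambda_u''=\tfrac{d^2}{dt^2}\Big|_{t=0}\lambda_{tu};$$ and, with $m=\sum_{s\in S}\mathrm{Tr}(L_s\rho^{\mathrm{inv}}L_s^*)\,s$,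 $$\frac{X_p-p\,m}{\sqrt p}\ \xrightarrow[p\to\infty]{}\ \mathcal N(0,C)\qquad\text{in law.}$$ -/

import Mathlib

open MeasureTheory ProbabilityTheory Filter
open scoped Topology

/-! ### Infinite trajectories in a countable set with prescribed cylinder probabilities -/

namespace TrajectoryLaw

variable {V : Type*}

/-- The cylinder set of the trajectories that agree with `x` up to time `n`. -/
def cyl (n : ℕ) (x : ℕ → V) : Set (ℕ → V) := {ω | ∀ k ≤ n, ω k = x k}

/-- A trajectory extending the finite trajectory `h`. -/
def extend {n : ℕ} (h : ↥(Finset.Iic n) → V) (k : ℕ) : V :=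
  h ⟨min k n, Finset.mem_Iic.2 (min_le_right k n)⟩

theorem extend_apply {n : ℕ} (h : ↥(Finset.Iic n) → V) {k : ℕ} (hk : k ≤ n) :
    extend h k = h ⟨k, Finset.mem_Iic.2 hk⟩ := by
  simp [extend, min_eq_left hk]

theorem preimage_singleton {n : ℕ} (h : ↥(Finset.Iic n) → V) :
    (Preorder.frestrictLe (π := fun _ => V) n) ⁻¹' {h} = cyl n (extend h) := by
  ext ω
  simp only [Set.mem_preimage, Set.mem_singleton_iff, cyl, Set.mem_ofPred_eq]
  constructor
  · rintro rfl k hk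
    rw [extend_apply _ hk]
    rfl
  · intro H
    funext k
    have hk := Finset.mem_Iic.1 k.2
    rw [show h k = extend h k from (extend_apply h hk).symm]
    exact H k hk

variable [MeasurableSpace V] [MeasurableSingletonClass V] [Countable V]

theorem measure_ext {P Q : Measure (ℕ → V)} [IsProbabilityMeasure P] [IsProbabilityMeasure Q]
    (h : ∀ n x, P (cyl n x) = Q (cyl n x)) : P = Q := by
  have hmap : ∀ n, P.map (Preorder.frestrictLe (π := fun _ => V) n)
      = Q.map (Preorder.frestrictLe (π := fun _ => V) n) := by
    intro n
    refine Measure.ext_of_singleton fun a => ?_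
    rw [Measure.map_apply (by fun_prop) (measurableSet_singleton _),
      Measure.map_apply (by fun_prop) (measurableSet_singleton _), preimage_singleton, h]
  have hfam : IsProjectiveMeasureFamily (fun I : Finset ℕ => P.map I.restrict) := by
    intro I J hJI
    simp only
    rw [Measure.map_map (by fun_prop) (by fun_prop)]
    rfl
  have hP : IsProjectiveLimit P (fun I : Finset ℕ => P.map I.restrict) := fun I => rfl
  have hQ : IsProjectiveLimit Q (fun I : Finset ℕ => P.map I.restrict) :=
    (isProjectiveLimit_nat_iff hfam Q).2 fun n => (hmap n).symm
  have : ∀ I : Finset ℕ, IsFiniteMeasure (P.map I.restrict) := fun I => inferInstance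
  exact hP.unique hQ

theorem existsUnique [Nonempty V] (w : ℕ → (ℕ → V) → ENNReal)
    (hloc : ∀ n x y, (∀ k ≤ n, x k = y k) → w n x = w n y)
    (h0 : ∑' v, w 0 (fun _ => v) = 1)
    (hs : ∀ n x, ∑' v, w (n + 1) (Function.update x (n + 1) v) = w n x) :
    ∃! P : Measure (ℕ → V), IsProbabilityMeasure P ∧ ∀ n x, P (cyl n x) = w n x := by
  classical
  have hle : ∀ n x, w n x ≤ 1 := by
    intro n
    induction n with
    | zero =>
      intro x
      rw [hloc 0 x (fun _ => x 0) (by intro k hk; simp [Nat.le_zero.1 hk]), ← h0]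
      exact ENNReal.le_tsum (f := fun v => w 0 (fun _ => v)) (x 0)
    | succ n ih =>
      intro x
      refine le_trans ?_ (ih x)
      rw [← hs n x]
      refine le_trans (le_of_eq ?_)
        (ENNReal.le_tsum (f := fun v => w (n + 1) (Function.update x (n + 1) v)) (x (n + 1)))
      simp
  have hfin : ∀ n x, w n x ≠ ⊤ := fun n x => ne_top_of_le_ne_top ENNReal.one_ne_top (hle n x)
  let μ₀ : Measure V := Measure.sum fun v => (w 0 fun _ => v) • Measure.dirac v
  have hμ₀s : ∀ v, μ₀ {v} = w 0 fun _ => v := by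
    intro v
    simp only [μ₀]
    rw [Measure.sum_apply _ (measurableSet_singleton _), tsum_eq_single v]
    · simp
    · intro b hb
      simp [hb]
  have hμ₀ : IsProbabilityMeasure μ₀ := ⟨by simp [μ₀, Measure.sum_apply, h0]⟩
  let κf : ∀ n, (↥(Finset.Iic n) → V) → Measure V := fun n h =>
    if w n (extend h) = 0 then Measure.dirac (Classical.arbitrary V)
    else Measure.sum fun v =>
      (w (n + 1) (Function.update (extend h) (n + 1) v) / w n (extend h)) • Measure.dirac v
  let κ : ∀ n, Kernel (↥(Finset.Iic n) → V) V := fun n => Kernel.ofFunOfCountable (κf n)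
  have hκ : ∀ n, IsMarkovKernel (κ n) := by
    intro n
    refine ⟨fun h => ?_⟩
    change IsProbabilityMeasure (κf n h)
    simp only [κf]
    split_ifs with hz
    · infer_instance
    · refine ⟨?_⟩
      simp only [Measure.sum_apply _ MeasurableSet.univ, Measure.smul_apply, measure_univ,
        smul_eq_mul, mul_one, ENNReal.div_eq_inv_mul]
      rw [ENNReal.tsum_mul_left, hs, ENNReal.inv_mul_cancel hz (hfin _ _)]
  have hκs : ∀ n h v, w n (extend h) ≠ 0 → κ n h {v}
      = w (n + 1) (Function.update (extend h) (n + 1) v) / w n (extend h) := by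
    intro n h v hz
    change κf n h {v} = _
    simp only [κf, if_neg hz]
    rw [Measure.sum_apply _ (measurableSet_singleton _), tsum_eq_single v]
    · simp
    · intro b hb
      simp [hb]
  let P : Measure (ℕ → V) := Kernel.trajMeasure (X := fun _ => V) μ₀ κ
  have hP : IsProbabilityMeasure P := by
    simp only [P]
    infer_instance
  have hcomp : ∀ n, P.map (Preorder.frestrictLe (π := fun _ => V) n) ⊗ₘ κ n
      = P.map (fun x => (Preorder.frestrictLe (π := fun _ => V) n x, x (n + 1))) := fun n =>
    Kernel.map_frestrictLe_trajMeasure_compProd_eq_map_trajMeasure (X := fun _ => V)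
  have hP0 : ∀ x : ℕ → V, P (cyl 0 x) = w 0 x := by
    intro x
    let h : ↥(Finset.Iic 0) → V := Preorder.frestrictLe (π := fun _ => V) 0 x
    have hc : cyl 0 x = cyl 0 (extend h) := by
      ext ω
      simp only [cyl, Set.mem_ofPred_eq]
      refine forall₂_congr fun k hk => ?_
      rw [extend_apply h hk]
      rfl
    have hmap : P.map (Preorder.frestrictLe (π := fun _ => V) 0)
        = μ₀.map (MeasurableEquiv.piUnique (fun _ : ↥(Finset.Iic 0) => V)).symm := by
      simp only [P, Kernel.trajMeasure]
      rw [Measure.map_comp _ _ (by fun_prop), Kernel.traj_map_frestrictLe,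
        Kernel.partialTraj_self, Measure.id_comp]
    rw [hc, ← preimage_singleton, ← Measure.map_apply (by fun_prop) (measurableSet_singleton _),
      hmap, Measure.map_apply (by fun_prop) (measurableSet_singleton _)]
    have hpre : (MeasurableEquiv.piUnique (fun _ : ↥(Finset.Iic 0) => V)).symm ⁻¹' {h}
        = {x 0} := by
      ext v
      simp only [Set.mem_preimage, Set.mem_singleton_iff]
      constructor
      · intro H
        exact congrFun H ⟨0, Finset.mem_Iic.2 le_rfl⟩
      · rintro rfl
        funext k
        have hk : (k : ℕ) = 0 := Nat.le_zero.1 (Finset.mem_Iic.1 k.2)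
        change x 0 = x k
        rw [hk]
    rw [hpre, hμ₀s]
    exact hloc 0 _ _ fun k hk => by simp [Nat.le_zero.1 hk]
  have hcyl : ∀ n x, P (cyl n x) = w n x := by
    intro n
    induction n with
    | zero => exact hP0
    | succ n ih =>
      intro x
      let h : ↥(Finset.Iic n) → V := Preorder.frestrictLe (π := fun _ => V) n x
      have hx : ∀ k ≤ n, extend h k = x k := fun k hk => by rw [extend_apply h hk]; rfl
      have hw : w n (extend h) = w n x := hloc n _ _ hx
      have hpre : (fun y : ℕ → V => (Preorder.frestrictLe (π := fun _ => V) n y, y (n + 1))) ⁻¹'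
          ({h} ×ˢ {x (n + 1)}) = cyl (n + 1) x := by
        ext ω
        have := Set.ext_iff.1 (preimage_singleton h) ω
        simp only [Set.mem_preimage, Set.mem_singleton_iff, cyl, Set.mem_ofPred_eq] at this
        simp only [Set.mem_preimage, Set.mem_prod, Set.mem_singleton_iff, cyl, Set.mem_ofPred_eq,
          this]
        constructor
        · rintro ⟨h1, h2⟩ k hk
          rcases Nat.lt_or_ge n k with hk' | hk'
          · obtain rfl : k = n + 1 := by omega
            exact h2
          · rw [h1 k hk', hx k hk']
        · intro H
          exact ⟨fun k hk => by rw [H k (by omega), hx k hk], H _ le_rfl⟩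
      have hsing : P.map (Preorder.frestrictLe (π := fun _ => V) n) {h} = w n x := by
        rw [Measure.map_apply (by fun_prop) (measurableSet_singleton _), preimage_singleton, ih, hw]
      have key := congrArg (fun m => m ({h} ×ˢ {x (n + 1)})) (hcomp n)
      rw [Measure.compProd_apply_prod (measurableSet_singleton _) (measurableSet_singleton _),
        Measure.map_apply (by fun_prop)
          ((measurableSet_singleton _).prod (measurableSet_singleton _)), hpre,
        lintegral_singleton, hsing] at key
      rw [← key]
      have hupd : w (n + 1) (Function.update (extend h) (n + 1) (x (n + 1))) = w (n + 1) x := by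
        refine hloc _ _ _ fun k hk => ?_
        rcases Nat.lt_or_ge n k with hk' | hk'
        · obtain rfl : k = n + 1 := by omega
          simp
        · rw [Function.update_of_ne (by omega), hx k hk']
      by_cases hz : w n x = 0
      · have h1 : w (n + 1) x ≤ w n x := by
          rw [← hs n x]
          refine le_trans (le_of_eq ?_)
            (ENNReal.le_tsum (f := fun v => w (n + 1) (Function.update x (n + 1) v)) (x (n + 1)))
          simp
        rw [hz, mul_zero, eq_comm]
        exact le_antisymm (h1.trans hz.le) (by simp)
      · rw [hκs n h _ (by rwa [hw]), hupd, hw, ENNReal.div_mul_cancel hz (hfin _ _)]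
  refine ⟨P, ⟨hP, hcyl⟩, ?_⟩
  rintro Q ⟨hQ, hQc⟩
  exact measure_ext fun n x => by rw [hQc, hcyl]

end TrajectoryLaw

/-! ### Completely positive maps on the operators of a finite-dimensional Hilbert space -/

section Maps

variable {𝔥 : Type*} [NormedAddCommGroup 𝔥] [InnerProductSpace ℂ 𝔥] [CompleteSpace 𝔥]
  [FiniteDimensional ℂ 𝔥]

/-- The trace of an operator. -/
noncomputable def opTrace : (𝔥 →L[ℂ] 𝔥) →ₗ[ℂ] ℂ :=
  LinearMap.trace ℂ 𝔥 ∘ₗ ContinuousLinearMap.coeLM ℂ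

/-- The map `X ↦ ∑ₖ Aₖ X Aₖ*` with Kraus operators `Aₖ`, as a bounded operator on `𝓑(𝔥)`. -/
noncomputable def krausMap {ι : Type*} (A : ι → 𝔥 →L[ℂ] 𝔥) :
    (𝔥 →L[ℂ] 𝔥) →L[ℂ] (𝔥 →L[ℂ] 𝔥) :=
  ∑' k, ContinuousLinearMap.mulLeftRight ℂ (𝔥 →L[ℂ] 𝔥) (A k) (ContinuousLinearMap.adjoint (A k))

/-- `Φ` is irreducible: the only orthogonal projections `P` with `Φ(P 𝓑(𝔥) P) ⊆ P 𝓑(𝔥) P` are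
`0` and the identity. -/
def IsIrreducibleMap (Φ : (𝔥 →L[ℂ] 𝔥) →L[ℂ] (𝔥 →L[ℂ] 𝔥)) : Prop :=
  ∀ P : 𝔥 →L[ℂ] 𝔥, IsStarProjection P →
    (∀ X : 𝔥 →L[ℂ] 𝔥, ∃ Y : 𝔥 →L[ℂ] 𝔥, Φ (P * X * P) = P * Y * P) → P = 0 ∨ P = 1

/-- `σ` is a state that is invariant under `Φ`. -/
def IsInvariantState (Φ : (𝔥 →L[ℂ] 𝔥) →L[ℂ] (𝔥 →L[ℂ] 𝔥)) (σ : 𝔥 →L[ℂ] 𝔥) : Prop :=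
  σ.IsPositive ∧ opTrace σ = 1 ∧ Φ σ = σ

end Maps

/-! ### Homogeneous open quantum random walks -/

/-- A homogeneous open quantum random walk on a locally finite lattice `V ⊆ ℝᵈ`, positively
generated by the set `S`, with internal space `𝔥` and transition operators `L s`, `s ∈ S`.
The family `L` is extended by `0` to `V`, so that sums over `S` may be written as sums over `V`. -/
structure OQRW (d : ℕ) (𝔥 : Type*) [NormedAddCommGroup 𝔥] [InnerProductSpace ℂ 𝔥]
    [CompleteSpace 𝔥] [FiniteDimensional ℂ 𝔥] where
  V : AddSubgroup (EuclideanSpace ℝ (Fin d))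
  discrete : DiscreteTopology V
  S : Set V
  generates : AddSubmonoid.closure S = ⊤
  L : V → 𝔥 →L[ℂ] 𝔥
  L_eq_zero : ∀ v, v ∉ S → L v = 0
  stochastic : HasSum (fun s => ContinuousLinearMap.adjoint (L s) * L s) 1

namespace OQRW

variable {d : ℕ} {𝔥 : Type*} [NormedAddCommGroup 𝔥] [InnerProductSpace ℂ 𝔥]
  [CompleteSpace 𝔥] [FiniteDimensional ℂ 𝔥]

instance (W : OQRW d 𝔥) : Countable W.V :=
  haveI := W.discrete
  countable_of_Lindelof_of_discrete

/-- The auxiliary map `𝔏 : X ↦ ∑ₛ Lₛ X Lₛ*`. -/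
noncomputable def aux (W : OQRW d 𝔥) : (𝔥 →L[ℂ] 𝔥) →L[ℂ] (𝔥 →L[ℂ] 𝔥) :=
  krausMap W.L

/-- The deformed map `𝔏ᵤ`, with Kraus operators `exp(⟨u, s⟩ / 2) Lₛ`. -/
noncomputable def auxDeformed (W : OQRW d 𝔥) (u : EuclideanSpace ℝ (Fin d)) :
    (𝔥 →L[ℂ] 𝔥) →L[ℂ] (𝔥 →L[ℂ] 𝔥) :=
  krausMap fun s : W.V => ((Real.exp (inner ℝ u (s : EuclideanSpace ℝ (Fin d)) / 2) : ℝ) : ℂ) • W.L s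

/-- The series that defines `𝔏ᵤ` converges for every `u`. -/
def DeformationsConverge (W : OQRW d 𝔥) : Prop :=
  ∀ u : EuclideanSpace ℝ (Fin d),
    Summable fun s : W.V => Real.exp (inner ℝ u (s : EuclideanSpace ℝ (Fin d))) * ‖W.L s‖ ^ 2

/-- The condition holds automatically when `S` is finite. -/
theorem deformationsConverge_of_finite (W : OQRW d 𝔥) (h : W.S.Finite) :
    W.DeformationsConverge := fun u =>
  summable_of_ne_finset_zero (s := h.toFinset) fun v hv => by
    rw [W.L_eq_zero v (by simpa using hv)]
    simp

/-- The spectral radius `λᵤ` of `𝔏ᵤ`. -/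
noncomputable def lam (W : OQRW d 𝔥) (u : EuclideanSpace ℝ (Fin d)) : ℝ :=
  (spectralRadius ℂ (W.auxDeformed u)).toReal

/-- The function `u ↦ log λᵤ`. -/
noncomputable def logLam (W : OQRW d 𝔥) (u : EuclideanSpace ℝ (Fin d)) : ℝ :=
  Real.log (W.lam u)

/-- The Hessian matrix at `0` of `u ↦ log λᵤ`. -/
noncomputable def covMatrix (W : OQRW d 𝔥) : Matrix (Fin d) (Fin d) ℝ :=
  Matrix.of fun i j => iteratedFDeriv ℝ 2 W.logLam 0
    ![EuclideanSpace.single i (1 : ℝ), EuclideanSpace.single j (1 : ℝ)]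

/-- The vector `∑ₛ Tr(Lₛ σ Lₛ*) s`. -/
noncomputable def drift (W : OQRW d 𝔥) (σ : 𝔥 →L[ℂ] 𝔥) : EuclideanSpace ℝ (Fin d) :=
  ∑' s : W.V, (opTrace (W.L s * σ * ContinuousLinearMap.adjoint (W.L s))).re •
    (s : EuclideanSpace ℝ (Fin d))

/-- A state `∑ᵢ ρ(i) ⊗ |i⟩⟨i|` on `𝔥 ⊗ ℂ^V`, given by its diagonal blocks `ρ(i)`. -/
structure DiagState (W : OQRW d 𝔥) where
  block : W.V → 𝔥 →L[ℂ] 𝔥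
  isPositive : ∀ i, (block i).IsPositive
  hasSum_trace : HasSum (fun i => opTrace (block i)) 1

/-- The operator `L_{sₙ} ⋯ L_{s₁} ρ(x₀) L_{s₁}* ⋯ L_{sₙ}*` of a trajectory `x`, where
`sₖ = xₖ - xₖ₋₁`. -/
noncomputable def trajOp (W : OQRW d 𝔥) (ρ : W.DiagState) (x : ℕ → W.V) : ℕ → 𝔥 →L[ℂ] 𝔥
  | 0 => ρ.block (x 0)
  | n + 1 => W.L (x (n + 1) - x n) * trajOp W ρ x n *
      ContinuousLinearMap.adjoint (W.L (x (n + 1) - x n))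

theorem trajOp_congr (W : OQRW d 𝔥) (ρ : W.DiagState) (n : ℕ) (x y : ℕ → W.V)
    (h : ∀ k ≤ n, x k = y k) : W.trajOp ρ x n = W.trajOp ρ y n := by
  induction n with
  | zero => simp [trajOp, h 0 le_rfl]
  | succ n ih =>
    simp only [trajOp]
    rw [ih fun k hk => h k (by omega), h (n + 1) le_rfl, h n (by omega)]

theorem trajOp_isPositive (W : OQRW d 𝔥) (ρ : W.DiagState) (x : ℕ → W.V) (n : ℕ) :
    (W.trajOp ρ x n).IsPositive := by
  induction n with
  | zero => exact ρ.isPositive _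
  | succ n ih => exact ih.conj_adjoint _

set_option linter.unusedSectionVars false in
theorem opTrace_re_nonneg {A : 𝔥 →L[ℂ] 𝔥} (h : A.IsPositive) : 0 ≤ (opTrace A).re :=
  (Complex.le_def.1 (ContinuousLinearMap.isPositive_toLinearMap_iff A |>.2 h).trace_nonneg).1

theorem hasSum_step (W : OQRW d 𝔥) (A : 𝔥 →L[ℂ] 𝔥) (v : W.V) :
    HasSum (fun j => (opTrace (W.L (j - v) * A * ContinuousLinearMap.adjoint (W.L (j - v)))).re)
      (opTrace A).re := by
  let f : (𝔥 →L[ℂ] 𝔥) →ₗ[ℂ] ℂ := opTrace ∘ₗ LinearMap.mulLeft ℂ A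
  have hf : Continuous f := f.continuous_of_finiteDimensional
  have h1 := (W.stochastic.map f hf)
  have h2 := (Equiv.subRight v).hasSum_iff.2 h1
  have h3 := Complex.hasSum_re h2
  convert! h3 using 1
  · funext j
    simp only [f, Function.comp, LinearMap.comp_apply, LinearMap.mulLeft_apply, Equiv.subRight_apply]
    congr 1
    simp only [opTrace, LinearMap.comp_apply, ContinuousLinearMap.coeLM_apply,
      ContinuousLinearMap.toLinearMap_mul]
    rw [mul_assoc, LinearMap.trace_mul_comm, mul_assoc]

/-- The law `ℙ_ρ` on `V^ℕ` exists and is unique. -/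
theorem existsUnique_law (W : OQRW d 𝔥) (ρ : W.DiagState) :
    ∃! P : Measure (ℕ → W.V), IsProbabilityMeasure P ∧ ∀ (n : ℕ) (x : ℕ → W.V),
      P (TrajectoryLaw.cyl n x) = ENNReal.ofReal (opTrace (W.trajOp ρ x n)).re := by
  refine TrajectoryLaw.existsUnique (fun n x => ENNReal.ofReal (opTrace (W.trajOp ρ x n)).re)
    ?_ ?_ ?_
  · intro n x y h
    simp only [W.trajOp_congr ρ n x y h]
  · have h := Complex.hasSum_re ρ.hasSum_trace
    simp only [trajOp]
    rw [← ENNReal.ofReal_tsum_of_nonneg (fun i => opTrace_re_nonneg (ρ.isPositive i)) h.summable,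
      h.tsum_eq]
    simp
  · intro n x
    have h := W.hasSum_step (W.trajOp ρ x n) (x n)
    have hpos : ∀ j, 0 ≤ (opTrace (W.L (j - x n) * W.trajOp ρ x n *
        ContinuousLinearMap.adjoint (W.L (j - x n)))).re := fun j =>
      opTrace_re_nonneg ((W.trajOp_isPositive ρ x n).conj_adjoint _)
    have hupd : ∀ v, W.trajOp ρ (Function.update x (n + 1) v) n = W.trajOp ρ x n := fun v =>
      W.trajOp_congr ρ n _ _ fun k hk => Function.update_of_ne (by omega) _ _
    simp only [trajOp, hupd, Function.update_self,
      Function.update_of_ne (show n ≠ n + 1 by omega)]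
    rw [← ENNReal.ofReal_tsum_of_nonneg
      (fun i => hpos i) h.summable, h.tsum_eq]

/-- The law `ℙ_ρ` on `V^ℕ` of the position process with initial state `ρ`: the unique probability
measure with `ℙ_ρ(X₀ = x₀, …, Xₙ = xₙ) = Tr(L_{sₙ} ⋯ L_{s₁} ρ(x₀) L_{s₁}* ⋯ L_{sₙ}*)`, where
`sₖ = xₖ - xₖ₋₁` (and `L_s = 0` for `s ∉ S`). -/
noncomputable def law (W : OQRW d 𝔥) (ρ : W.DiagState) : Measure (ℕ → W.V) :=
  (W.existsUnique_law ρ).choose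

instance (W : OQRW d 𝔥) (ρ : W.DiagState) : IsProbabilityMeasure (W.law ρ) :=
  (W.existsUnique_law ρ).choose_spec.1.1

theorem law_cyl (W : OQRW d 𝔥) (ρ : W.DiagState) (n : ℕ) (x : ℕ → W.V) :
    W.law ρ (TrajectoryLaw.cyl n x) = ENNReal.ofReal (opTrace (W.trajOp ρ x n)).re :=
  (W.existsUnique_law ρ).choose_spec.1.2 n x

/-- The position `X_p`: the coordinate maps on `V^ℕ`, with values in `ℝᵈ`. -/
def pos (W : OQRW d 𝔥) (p : ℕ) (ω : ℕ → W.V) : EuclideanSpace ℝ (Fin d) := ω p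

end OQRW

/-! The argument is the Fourier method of Nagaev and Guivarc'h, with the deformed map in the role of
the transfer operator. Write `𝔏_z` for the deformation with complex parameter `z` (`cDeformed`) and
`ρ̂(θ) = ∑ᵥ exp(i⟨θ, v⟩) ρ(v)`. Summing over paths gives `𝔼 exp(i⟨θ, X_p⟩) = Tr (𝔏_{iθ}^p ρ̂(θ))`
(`integral_phase_pos`), so the problem is to describe `𝔏_z^p` for `z` near `0`.

The trace is a left eigenvector of `𝔏` with eigenvalue `1`. Irreducibility makes invariant states
faithful, and a fixed point of trace zero then vanishes (`eq_zero_of_fixed`): the eigenvalue is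
simple. The implicit function theorem continues it to a pair `g_z ∘ 𝔏_z = Λ(z) g_z` with `g_0 = Tr`
(`exists_eigenvalue_branch`). For small real `u`, positivity and the closeness of `g_u` to the trace
give spectral radius `|Λ(u)|` (`spectralRadius_eq_of_left_eigenvector`), and local uniqueness makes
`Λ(u)` real; thus `λᵤ = Λ(u)`.

No spectral gap is needed, so periodicity is harmless. Split `Tr = g_z + (Tr - g_z)` at `z = iu/√p`.
The first part equals `Λ(z)^p g_z(ρ̂)`. The second tends to `0` because `‖𝔏_{iθ}^p ρ̂(θ)‖ ≤ 1`
uniformly in `p` and `θ` (`norm_cDeformed_pow_le`). A second-order Taylor expansion of `Λ` along the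
line through `u` gives the Gaussian limit of the centred characteristic function, and Lévy's
continuity theorem concludes. The Hessian is positive semidefinite because a limit of characteristic
functions is bounded by `1`. -/

/-! ### Smoothness of exponential series -/

theorem hasFDerivAt_tsum_exp_smul {ι E F : Type*} [NormedAddCommGroup E] [NormedSpace ℂ E]
    [NormedAddCommGroup F] [NormedSpace ℂ F] [CompleteSpace F] (ℓ : ι → E →L[ℂ] ℂ) (K : ι → F)
    (h : ∀ r : ℝ, Summable fun i => Real.exp (r * ‖ℓ i‖) * ‖K i‖) (x : E) :
    HasFDerivAt (fun x => ∑' i, Complex.exp (ℓ i x) • K i)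
      (∑' i, Complex.exp (ℓ i x) • (ℓ i).smulRight (K i)) x := by
  have hexp : ∀ (i : ι) (y : E), ‖Complex.exp (ℓ i y)‖ ≤ Real.exp (‖y‖ * ‖ℓ i‖) := fun i y => by
    rw [Complex.norm_exp]
    refine Real.exp_le_exp.2 ((Complex.re_le_norm _).trans ?_)
    rw [mul_comm]
    exact (ℓ i).le_opNorm y
  have hpre : IsPreconnected (Metric.ball x 1) := by
    have hc : Convex ℝ (Metric.ball x 1) := convex_ball x 1
    exact hc.isPreconnected
  -- In the majorant exponent `‖x‖ + 2`, one unit is the radius of the ball and the other absorbs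
  -- the factor `‖ℓ i‖ ≤ exp ‖ℓ i‖` produced by differentiation.
  refine hasFDerivAt_tsum_of_isPreconnected (𝕜 := ℂ) (F := F)
    (f := fun i y => Complex.exp (ℓ i y) • K i)
    (f' := fun i y => Complex.exp (ℓ i y) • (ℓ i).smulRight (K i)) (h (‖x‖ + 2)) (Metric.isOpen_ball (x := x) (ε := 1))
    hpre (fun i y _ => ?_) (fun i y hy => ?_)
    (Metric.mem_ball_self one_pos) ?_ (Metric.mem_ball_self one_pos)
  · have := ((ℓ i).hasFDerivAt (x := y)).cexp.smul_const (K i)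
    convert! this using 1
    ext v
    simp [smul_smul]
  · have hy' : ‖y‖ ≤ ‖x‖ + 1 := by
      have := norm_le_norm_add_norm_sub' y x
      have h2 : ‖y - x‖ < 1 := by simpa [dist_eq_norm] using hy
      linarith
    rw [norm_smul, ContinuousLinearMap.norm_smulRight_apply, ← mul_assoc]
    refine mul_le_mul_of_nonneg_right ?_ (norm_nonneg _)
    have h1 : ‖ℓ i‖ ≤ Real.exp ‖ℓ i‖ := by linarith [Real.add_one_le_exp ‖ℓ i‖]
    calc ‖Complex.exp (ℓ i y)‖ * ‖ℓ i‖ ≤ Real.exp ((‖x‖ + 1) * ‖ℓ i‖) * Real.exp ‖ℓ i‖ := by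
          gcongr
          exact (hexp i y).trans (Real.exp_le_exp.2 (by gcongr))
      _ = Real.exp ((‖x‖ + 2) * ‖ℓ i‖) := by rw [← Real.exp_add]; ring_nf
  · refine Summable.of_norm_bounded (h ‖x‖) fun i => ?_
    rw [norm_smul]
    gcongr
    exact hexp i x

/-- The differentiated series has the same form, with coefficients `(ℓ i).smulRight (K i)`; since
the summability condition is inherited, differentiation can be repeated. -/
theorem summable_exp_mul_norm_smulRight {ι E F : Type*} [NormedAddCommGroup E] [NormedSpace ℂ E]
    [NormedAddCommGroup F] [NormedSpace ℂ F] [CompleteSpace F] (ℓ : ι → E →L[ℂ] ℂ) (K : ι → F)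
    (h : ∀ r : ℝ, Summable fun i => Real.exp (r * ‖ℓ i‖) * ‖K i‖) (r : ℝ) :
    Summable fun i => Real.exp (r * ‖ℓ i‖) * ‖(ℓ i).smulRight (K i)‖ := by
  refine Summable.of_nonneg_of_le (fun i => by positivity) (fun i => ?_) (h (r + 1))
  have h1 : ‖ℓ i‖ ≤ Real.exp ‖ℓ i‖ := by linarith [Real.add_one_le_exp ‖ℓ i‖]
  rw [ContinuousLinearMap.norm_smulRight_apply, ← mul_assoc]
  refine mul_le_mul_of_nonneg_right ?_ (norm_nonneg _)
  rw [add_mul, Real.exp_add, one_mul]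
  gcongr

theorem hasSum_fderiv_tsum_exp_smul {ι E F : Type*} [NormedAddCommGroup E] [NormedSpace ℂ E]
    [NormedAddCommGroup F] [NormedSpace ℂ F] [CompleteSpace F] (ℓ : ι → E →L[ℂ] ℂ) (K : ι → F)
    (h : ∀ r : ℝ, Summable fun i => Real.exp (r * ‖ℓ i‖) * ‖K i‖) (v : E) :
    HasSum (fun i => ℓ i v • K i) (fderiv ℂ (fun x => ∑' i, Complex.exp (ℓ i x) • K i) 0 v) := by
  have h1 : Summable fun i => (ℓ i).smulRight (K i) := by
    refine Summable.of_norm ?_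
    simpa only [zero_mul, Real.exp_zero, one_mul] using summable_exp_mul_norm_smulRight ℓ K h 0
  have h2 : fderiv ℂ (fun x => ∑' i, Complex.exp (ℓ i x) • K i) 0 =
      ∑' i, (ℓ i).smulRight (K i) := by
    rw [(hasFDerivAt_tsum_exp_smul ℓ K h 0).fderiv]
    simp only [map_zero, Complex.exp_zero, one_smul]
  rw [h2]
  exact h1.hasSum.mapL (ContinuousLinearMap.apply ℂ F v)

theorem contDiff_one_tsum_exp_smul {ι E F : Type*} [NormedAddCommGroup E] [NormedSpace ℂ E]
    [NormedAddCommGroup F] [NormedSpace ℂ F] [CompleteSpace F] (ℓ : ι → E →L[ℂ] ℂ) (K : ι → F)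
    (h : ∀ r : ℝ, Summable fun i => Real.exp (r * ‖ℓ i‖) * ‖K i‖) :
    ContDiff ℂ 1 (fun x => ∑' i, Complex.exp (ℓ i x) • K i) := by
  have h1 := summable_exp_mul_norm_smulRight ℓ K h
  refine contDiff_one_iff_hasFDerivAt.2 ⟨_, ?_, hasFDerivAt_tsum_exp_smul ℓ K h⟩
  exact continuous_iff_continuousAt.2 fun x => (hasFDerivAt_tsum_exp_smul ℓ _ h1 x).continuousAt

theorem contDiff_two_tsum_exp_smul {ι E F : Type*} [NormedAddCommGroup E] [NormedSpace ℂ E]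
    [NormedAddCommGroup F] [NormedSpace ℂ F] [CompleteSpace F] (ℓ : ι → E →L[ℂ] ℂ) (K : ι → F)
    (h : ∀ r : ℝ, Summable fun i => Real.exp (r * ‖ℓ i‖) * ‖K i‖) :
    ContDiff ℂ 2 (fun x => ∑' i, Complex.exp (ℓ i x) • K i) := by
  have h1 := summable_exp_mul_norm_smulRight ℓ K h
  rw [show (2 : WithTop ℕ∞) = 1 + 1 from one_add_one_eq_two.symm]
  exact contDiff_succ_iff_hasFDerivAt.2
    ⟨_, contDiff_one_tsum_exp_smul ℓ _ h1, hasFDerivAt_tsum_exp_smul ℓ K h⟩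

/-! ### Perturbation of a simple eigenvalue -/

/-- Near an operator `T₀` with simple eigenvalue `1`, the eigenvalue and the left eigenvector
depend smoothly on the operator. -/
theorem exists_eigenvalue_branch {X : Type*} [NormedAddCommGroup X] [NormedSpace ℂ X]
    [FiniteDimensional ℂ X] (T₀ : X →L[ℂ] X) (τ : X →L[ℂ] ℂ) (σ : X) (hσ : T₀ σ = σ)
    (hτ : τ ∘L T₀ = τ) (hτσ : τ σ = 1) (hker : ∀ x, T₀ x = x → τ x = 0 → x = 0) :
    ∃ (μ : (X →L[ℂ] X) → ℂ) (g : (X →L[ℂ] X) → (X →L[ℂ] ℂ)),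
      ContDiffAt ℂ 2 μ T₀ ∧ ContDiffAt ℂ 2 g T₀ ∧ μ T₀ = 1 ∧ g T₀ = τ ∧
      (∀ᶠ T in 𝓝 T₀, g T ∘L T = μ T • g T ∧ g T σ = 1) ∧
      (∀ᶠ v in 𝓝 (T₀, τ, (1 : ℂ)), v.2.1 ∘L v.1 = v.2.2 • v.2.1 → v.2.1 σ = 1 → v.2.2 = μ v.1) ∧
      ∀ Ψ, fderiv ℂ μ T₀ Ψ = τ (Ψ σ) := by
  have : CompleteSpace X := FiniteDimensional.complete ℂ X
  -- The equation `f (T, φ, ν) = (0, 1)` says that `φ` is a left eigenvector of `T` with eigenvalue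
  -- `ν`, normalized by `φ σ = 1`.
  let f : (X →L[ℂ] X) × ((X →L[ℂ] ℂ) × ℂ) → (X →L[ℂ] ℂ) × ℂ :=
    fun v => (v.2.1 ∘L v.1 - v.2.2 • v.2.1, v.2.1 σ)
  let u : (X →L[ℂ] X) × ((X →L[ℂ] ℂ) × ℂ) := (T₀, τ, 1)
  have cdf : ContDiffAt ℂ 2 f u := by
    have : ContDiff ℂ 2 f := by
      have h1 : ContDiff ℂ 2 fun v : (X →L[ℂ] X) × ((X →L[ℂ] ℂ) × ℂ) => v.1 := contDiff_fst
      have h2 : ContDiff ℂ 2 fun v : (X →L[ℂ] X) × ((X →L[ℂ] ℂ) × ℂ) => v.2.1 :=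
        contDiff_fst.comp contDiff_snd
      have h3 : ContDiff ℂ 2 fun v : (X →L[ℂ] X) × ((X →L[ℂ] ℂ) × ℂ) => v.2.2 :=
        contDiff_snd.comp contDiff_snd
      exact ((h2.clm_comp h1).sub (h3.smul h2)).prodMk (h2.clm_apply contDiff_const)
    exact this.contDiffAt
  let A : (X →L[ℂ] ℂ) × ℂ →L[ℂ] (X →L[ℂ] ℂ) × ℂ := fderiv ℂ f u ∘L .inr ℂ _ _
  have hA : ∀ Y ν, A (Y, ν) = (Y ∘L T₀ - Y - ν • τ, Y σ) := by
    intro Y ν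
    have hline : HasDerivAt (fun t : ℂ => f (u + t • (0, Y, ν))) (fderiv ℂ f u (0, Y, ν)) 0 := by
      have h1 : HasFDerivAt f (fderiv ℂ f u) (u + (0 : ℂ) • (0, Y, ν)) := by
        rw [show u + (0 : ℂ) • ((0, Y, ν) : (X →L[ℂ] X) × ((X →L[ℂ] ℂ) × ℂ)) = u by
          ext <;> simp [u]]
        exact (cdf.differentiableAt (by norm_num)).hasFDerivAt
      have h2 : HasDerivAt (fun t : ℂ => u + t • ((0, Y, ν) : (X →L[ℂ] X) × ((X →L[ℂ] ℂ) × ℂ)))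
          (0, Y, ν) 0 := by
        simpa using! ((hasDerivAt_id (0 : ℂ)).smul_const
          ((0, Y, ν) : (X →L[ℂ] X) × ((X →L[ℂ] ℂ) × ℂ))).const_add u
      exact h1.comp_hasDerivAt 0 h2
    have hline' : HasDerivAt (fun t : ℂ => f (u + t • (0, Y, ν)))
        (Y ∘L T₀ - Y - ν • τ, Y σ) 0 := by
      -- Along this line `f` is a quadratic polynomial in `t`, so its derivative at `0` is the
      -- linear coefficient.
      have e : (fun t : ℂ => f (u + t • (0, Y, ν))) = fun t : ℂ =>
          f u + t • (Y ∘L T₀ - Y - ν • τ, Y σ) + t ^ 2 • (-(ν • Y), 0) := by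
        funext t
        simp only [f, u]
        ext1
        · ext x
          simp
          ring
        · simp
      rw [e]
      have h3 := (((hasDerivAt_id (0 : ℂ)).smul_const ((Y ∘L T₀ - Y - ν • τ, Y σ) :
        (X →L[ℂ] ℂ) × ℂ)).const_add (f u)).add
        (((hasDerivAt_pow 2 (0 : ℂ))).smul_const ((-(ν • Y), 0) : (X →L[ℂ] ℂ) × ℂ))
      convert! h3 using 1
      simp
    exact hline.unique hline'
  have hinj : Function.Injective A := by
    refine (injective_iff_map_eq_zero A).2 ?_
    rintro ⟨Y, ν⟩ h0
    rw [hA, Prod.mk_eq_zero] at h0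
    obtain ⟨h1, h2⟩ := h0
    have hν : ν = 0 := by
      have := congrArg (fun φ : X →L[ℂ] ℂ => φ σ) h1
      simpa [hσ, hτσ] using this
    subst hν
    -- Simplicity of the eigenvalue makes `T₀ - 1 + τ ⊗ σ` injective, hence onto. Since `Y ∘ T₀ = Y`
    -- and `Y σ = 0`, the functional `Y` vanishes on its range.
    have hB : Function.Injective
        (T₀ - 1 + τ.smulRight σ : X →L[ℂ] X).toLinearMap := by
      refine (injective_iff_map_eq_zero _).2 fun x hx => ?_
      have hx' : T₀ x - x + τ x • σ = 0 := by simpa using hx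
      have hτx : τ x = 0 := by
        have h3 := congrArg τ hx'
        have h4 : τ (T₀ x) = τ x := congrArg (fun φ : X →L[ℂ] ℂ => φ x) hτ
        simpa [h4, hτσ] using h3
      exact hker x (by simpa [hτx, sub_eq_zero] using hx') hτx
    have hsurj := LinearMap.injective_iff_surjective.1 hB
    have : Y = 0 := by
      ext y
      obtain ⟨x, rfl⟩ := hsurj y
      have h5 : Y (T₀ x) - Y x = 0 := by
        have := congrArg (fun φ : X →L[ℂ] ℂ => φ x) h1
        simpa using this
      simp [h5, h2]
    simp [this]
  have hinv : A.IsInvertible := by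
    have hs := LinearMap.injective_iff_surjective.1 (show Function.Injective A.toLinearMap from hinj)
    exact ⟨(LinearEquiv.ofBijective A.toLinearMap ⟨hinj, hs⟩).toContinuousLinearEquiv, by ext <;> rfl⟩
  have two : (2 : WithTop ℕ∞) ≠ 0 := by norm_num
  let ψ := cdf.implicitFunction two hinv
  have hψ : ContDiffAt ℂ 2 ψ T₀ := cdf.contDiffAt_implicitFunction two hinv
  have hψ0 : ψ T₀ = (τ, 1) := cdf.implicitFunction_apply_self two hinv
  have hfu : f u = (0, 1) := by simp [f, u, hτ, hτσ]
  have hev := cdf.eventually_apply_implicitFunction two hinv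
  rw [hfu] at hev
  have hiff := cdf.eventually_apply_eq_iff_implicitFunction two hinv
  rw [hfu] at hiff
  have heig : ∀ᶠ T in 𝓝 T₀, (ψ T).1 ∘L T = (ψ T).2 • (ψ T).1 ∧ (ψ T).1 σ = 1 := by
    filter_upwards [hev] with T hT
    have := Prod.mk.inj hT
    exact ⟨sub_eq_zero.1 this.1, this.2⟩
  have hg : ContDiffAt ℂ 2 (fun T => (ψ T).1) T₀ := hψ.fst
  have hμ : ContDiffAt ℂ 2 (fun T => (ψ T).2) T₀ := hψ.snd
  refine ⟨fun T => (ψ T).2, fun T => (ψ T).1, hμ, hg, by simp [hψ0], by simp [hψ0],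
    heig, ?_, fun Ψ => ?_⟩
  · filter_upwards [hiff] with v hv h1 h2
    have := hv.1 (by simp [f, h1, h2])
    exact (congrArg Prod.snd this).symm
  · have dg := (hg.differentiableAt two).hasFDerivAt
    -- The eigenvalue is `g_T (T σ)`. In its derivative the term that differentiates `g` drops out,
    -- because `T₀ σ = σ` and `g_T σ` is constant.
    have e1 : (fun T : X →L[ℂ] X => (ψ T).2) =ᶠ[𝓝 T₀] fun T => (ψ T).1 (T σ) := by
      filter_upwards [heig] with T hT
      have := congrArg (fun φ : X →L[ℂ] ℂ => φ σ) hT.1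
      simpa [hT.2] using this.symm
    have e2 : (fun T : X →L[ℂ] X => (ψ T).1 σ) =ᶠ[𝓝 T₀] fun _ => 1 :=
      heig.mono fun T h => h.2
    have d2 := (dg.clm_apply (hasFDerivAt_const σ T₀)).unique
      ((hasFDerivAt_const (1 : ℂ) T₀).congr_of_eventuallyEq e2)
    have d3 := dg.clm_apply (((ContinuousLinearMap.apply ℂ X σ).hasFDerivAt (x := T₀)))
    rw [e1.fderiv_eq]
    have d4 : fderiv ℂ (fun T : X →L[ℂ] X => (ψ T).1 (T σ)) T₀ = _ := d3.fderiv
    rw [d4]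
    have := congrArg (fun φ : (X →L[ℂ] X) →L[ℂ] ℂ => φ Ψ) d2
    simp at this
    simp [this, hσ, hψ0]

/-! ### Trace, positivity and the spectral radius -/

section Positivity

set_option linter.unusedSectionVars false

open scoped InnerProductSpace

variable {𝔥 : Type*} [NormedAddCommGroup 𝔥] [InnerProductSpace ℂ 𝔥] [CompleteSpace 𝔥]
  [FiniteDimensional ℂ 𝔥]

/-- The trace as a bounded functional. -/
noncomputable def opTraceL : (𝔥 →L[ℂ] 𝔥) →L[ℂ] ℂ := LinearMap.toContinuousLinearMap opTrace

@[simp]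
theorem opTraceL_apply (A : 𝔥 →L[ℂ] 𝔥) : opTraceL A = opTrace A := rfl

theorem opTrace_mul_comm (A B : 𝔥 →L[ℂ] 𝔥) : opTrace (A * B) = opTrace (B * A) := by
  simp only [opTrace, LinearMap.comp_apply, ContinuousLinearMap.coeLM_apply,
    ContinuousLinearMap.toLinearMap_mul]
  exact LinearMap.trace_mul_comm _ _ _

theorem opTrace_eq_sum_inner (A : 𝔥 →L[ℂ] 𝔥) :
    opTrace A = ∑ i, ⟪stdOrthonormalBasis ℂ 𝔥 i, A (stdOrthonormalBasis ℂ 𝔥 i)⟫_ℂ :=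
  LinearMap.trace_eq_sum_inner _ _

theorem opTrace_star (A : 𝔥 →L[ℂ] 𝔥) : opTrace (star A) = star (opTrace A) := by
  simp only [opTrace_eq_sum_inner, star_sum, ContinuousLinearMap.star_eq_adjoint,
    ContinuousLinearMap.adjoint_inner_right]
  simp

theorem opTrace_eq_re_of_isPositive {A : 𝔥 →L[ℂ] 𝔥} (h : A.IsPositive) :
    opTrace A = ((opTrace A).re : ℂ) := by
  have := opTrace_star A
  rw [h.isSelfAdjoint.star_eq] at this
  exact (Complex.conj_eq_iff_re.1 this.symm).symm

theorem norm_le_re_opTrace {A : 𝔥 →L[ℂ] 𝔥} (h : A.IsPositive) : ‖A‖ ≤ (opTrace A).re := by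
  obtain ⟨m, u, hu⟩ := ContinuousLinearMap.isPositive_iff_eq_sum_rankOne.1 h
  have : opTrace A = ((∑ i, ‖u i‖ ^ 2 : ℝ) : ℂ) := by
    rw [hu, map_sum, Complex.ofReal_sum]
    refine Finset.sum_congr rfl fun i _ => ?_
    rw [show opTrace (InnerProductSpace.rankOne ℂ (u i) (u i)) = ⟪u i, u i⟫_ℂ from
      InnerProductSpace.trace_rankOne _ _, inner_self_eq_norm_sq_to_K]
    simp
  rw [this, Complex.ofReal_re, hu]
  refine (norm_sum_le _ _).trans (Finset.sum_le_sum fun i _ => ?_)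
  simp [sq]

/-- On the positive cone the trace dominates the norm, so a functional close to the trace is
comparable to it there. This turns `g (T ^ n A) = μ ^ n g A` into a bound on `T ^ n A`. -/
theorem re_opTrace_le_norm (A : 𝔥 →L[ℂ] 𝔥) (g : (𝔥 →L[ℂ] 𝔥) →L[ℂ] ℂ) (hA : A.IsPositive)
    (hg : ‖g - opTraceL‖ ≤ 1 / 2) : (opTrace A).re ≤ 2 * ‖g A‖ := by
  have h1 : ‖g A - opTrace A‖ ≤ 1 / 2 * (opTrace A).re :=
    ((g - opTraceL).le_opNorm A).trans
      (mul_le_mul hg (norm_le_re_opTrace hA) (norm_nonneg _) (by norm_num))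
  have h2 : (opTrace A).re ≤ ‖opTrace A‖ := Complex.re_le_norm _
  have h3 := norm_sub_norm_le (opTrace A) (g A)
  rw [norm_sub_rev] at h3
  linarith

theorem apply_pow_of_left_eigenvector {X : Type*} [NormedAddCommGroup X] [NormedSpace ℂ X]
    (T : X →L[ℂ] X) (g : X →L[ℂ] ℂ) (μ : ℂ) (hμ : g ∘L T = μ • g) (n : ℕ) (x : X) :
    g ((T ^ n) x) = μ ^ n * g x := by
  induction n generalizing x with
  | zero => simp
  | succ n ih =>
    have := congrArg (fun φ : X →L[ℂ] ℂ => φ x) hμ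
    simp only [ContinuousLinearMap.comp_apply, smul_apply, smul_eq_mul] at this
    rw [pow_succ, mul_apply_eq_comp, ih, this, pow_succ, mul_assoc]

/-- A positivity preserving map with a left eigenvector close to the trace has the modulus of the
eigenvalue as its spectral radius. -/
theorem spectralRadius_eq_of_left_eigenvector [Nontrivial 𝔥]
    (T : (𝔥 →L[ℂ] 𝔥) →L[ℂ] (𝔥 →L[ℂ] 𝔥)) (hT : ∀ A, A.IsPositive → (T A).IsPositive)
    (g : (𝔥 →L[ℂ] 𝔥) →L[ℂ] ℂ) (hg : ‖g - opTraceL‖ ≤ 1 / 2) (μ : ℂ) (hμ : g ∘L T = μ • g) :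
    spectralRadius ℂ T = ‖μ‖₊ := by
  have hpow := apply_pow_of_left_eigenvector T g μ hμ
  have hTpow : ∀ n A, A.IsPositive → ((T ^ n) A).IsPositive := by
    intro n
    induction n with
    | zero => simp
    | succ n ih =>
      intro A hA
      rw [pow_succ, mul_apply_eq_comp]
      exact ih _ (hT _ hA)
  -- For positive `X` the bound comes from comparing `g` with the trace; it extends to all `X`
  -- because positive operators span. The constant may depend on `X`.
  have hbound : ∀ X, ∃ C : ℝ, ∀ n, ‖(T ^ n) X‖ ≤ C * ‖μ‖ ^ n := by
    intro X
    have hX : X ∈ Submodule.span ℂ {a : 𝔥 →L[ℂ] 𝔥 | 0 ≤ a} := by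
      rw [CStarAlgebra.span_nonneg]
      trivial
    induction hX using Submodule.span_induction with
    | mem x hx =>
      have hx' := (ContinuousLinearMap.nonneg_iff_isPositive x).1 hx
      refine ⟨2 * ‖g x‖, fun n => ?_⟩
      refine (norm_le_re_opTrace (hTpow n x hx')).trans
        ((re_opTrace_le_norm _ g (hTpow n x hx') hg).trans (le_of_eq ?_))
      rw [hpow, norm_mul, norm_pow]
      ring
    | zero => exact ⟨0, by simp⟩
    | add x y _ _ hx hy =>
      obtain ⟨C, hC⟩ := hx
      obtain ⟨D, hD⟩ := hy
      refine ⟨C + D, fun n => ?_⟩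
      rw [map_add, add_mul]
      exact (norm_add_le _ _).trans (add_le_add (hC n) (hD n))
    | smul a x _ hx =>
      obtain ⟨C, hC⟩ := hx
      refine ⟨‖a‖ * C, fun n => ?_⟩
      rw [map_smul, norm_smul, mul_assoc]
      exact mul_le_mul_of_nonneg_left (hC n) (norm_nonneg _)
  apply le_antisymm
  · refine iSup₂_le fun ν hν => ?_
    have hν' : ¬ Function.Injective (algebraMap ℂ ((𝔥 →L[ℂ] 𝔥) →L[ℂ] (𝔥 →L[ℂ] 𝔥)) ν - T) := by
      intro hinj
      refine hν ?_
      refine ContinuousLinearMap.isUnit_iff_bijective.2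
         ⟨hinj, LinearMap.injective_iff_surjective.1 (show Function.Injective (algebraMap ℂ _ ν - T :
          (𝔥 →L[ℂ] 𝔥) →L[ℂ] (𝔥 →L[ℂ] 𝔥)).toLinearMap from hinj)⟩
    rw [injective_iff_map_eq_zero] at hν'
    push Not at hν'
    obtain ⟨X, hX, hX0⟩ := hν'
    have hTX : T X = ν • X := by
      have : ν • X - T X = 0 := by simpa [Algebra.algebraMap_eq_smul_one] using hX
      exact (sub_eq_zero.1 this).symm
    have hTn : ∀ n, (T ^ n) X = ν ^ n • X := by
      intro n
      induction n with
      | zero => simp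
      | succ n ih =>
        rw [pow_succ, mul_apply_eq_comp, hTX, map_smul, ih, smul_smul, pow_succ,
          mul_comm]
    obtain ⟨C, hC⟩ := hbound X
    rw [ENNReal.coe_le_coe, ← NNReal.coe_le_coe, coe_nnnorm, coe_nnnorm]
    by_contra! hlt
    have hν0 : 0 < ‖ν‖ := (norm_nonneg _).trans_lt hlt
    have hlim : Tendsto (fun n : ℕ => C * (‖μ‖ / ‖ν‖) ^ n) atTop (𝓝 (C * 0)) :=
      (tendsto_pow_atTop_nhds_zero_of_lt_one (by positivity)
        ((div_lt_one hν0).2 hlt)).const_mul C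
    have hle : ‖X‖ ≤ C * 0 := by
      refine ge_of_tendsto' hlim fun n => ?_
      have := hC n
      rw [hTn, norm_smul, norm_pow] at this
      rw [div_pow, mul_div_assoc', le_div_iff₀ (by positivity), mul_comm]
      exact this
    rw [mul_zero] at hle
    exact hX0 (norm_le_zero_iff.1 hle)
  · refine le_iSup₂_of_le (f := fun k (_ : k ∈ spectrum ℂ T) => (‖k‖₊ : ENNReal)) μ ?_ le_rfl
    rintro ⟨U, hU⟩
    have h0 : g ∘L (U : (𝔥 →L[ℂ] 𝔥) →L[ℂ] (𝔥 →L[ℂ] 𝔥)) = 0 := by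
      rw [hU, ContinuousLinearMap.comp_sub, hμ]
      ext X
      simp [Algebra.algebraMap_eq_smul_one]
    have h1 : g 1 = 0 := by
      have h2 : (1 : 𝔥 →L[ℂ] 𝔥) = (U : (𝔥 →L[ℂ] 𝔥) →L[ℂ] (𝔥 →L[ℂ] 𝔥))
          ((↑U⁻¹ : (𝔥 →L[ℂ] 𝔥) →L[ℂ] (𝔥 →L[ℂ] 𝔥)) 1) := by
        rw [← mul_apply_eq_comp, Units.mul_inv, one_apply_eq_self]
      rw [h2, ← ContinuousLinearMap.comp_apply, h0]
      simp
    have h3 := re_opTrace_le_norm 1 g ContinuousLinearMap.isPositive_one hg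
    have h4 := norm_le_re_opTrace (𝔥 := 𝔥) ContinuousLinearMap.isPositive_one
    rw [h1] at h3
    simp at h3 h4
    linarith

/-- The functional `X ↦ conj (g (X*))`. -/
noncomputable def conjDual (g : (𝔥 →L[ℂ] 𝔥) →L[ℂ] ℂ) : (𝔥 →L[ℂ] 𝔥) →L[ℂ] ℂ :=
  LinearMap.mkContinuous
    { toFun := fun X => star (g (star X))
      map_add' := by simp
      map_smul' := by simp } ‖g‖ fun X => by
        simpa using g.le_opNorm (star X)

@[simp]
theorem conjDual_apply (g : (𝔥 →L[ℂ] 𝔥) →L[ℂ] ℂ) (X : 𝔥 →L[ℂ] 𝔥) :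
    conjDual g X = star (g (star X)) := rfl

theorem conjDual_opTraceL : conjDual (opTraceL : (𝔥 →L[ℂ] 𝔥) →L[ℂ] ℂ) = opTraceL := by
  ext X
  simp [opTrace_star]

theorem norm_conjDual_le (g : (𝔥 →L[ℂ] 𝔥) →L[ℂ] ℂ) : ‖conjDual g‖ ≤ ‖g‖ :=
  LinearMap.mkContinuous_norm_le _ (norm_nonneg _) _

theorem continuous_conjDual :
    Continuous (conjDual : ((𝔥 →L[ℂ] 𝔥) →L[ℂ] ℂ) → (𝔥 →L[ℂ] 𝔥) →L[ℂ] ℂ) := by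
  refine (LipschitzWith.of_dist_le_mul (K := 1) fun f g => ?_).continuous
  have : conjDual f - conjDual g = conjDual (f - g) := by
    ext X
    simp
  rw [dist_eq_norm, dist_eq_norm, this]
  simpa using norm_conjDual_le (f - g)

end Positivity

/-! ### Kraus maps: invariant states and irreducibility -/

section Kraus

set_option linter.unusedSectionVars false

open scoped InnerProductSpace

variable {𝔥 : Type*} [NormedAddCommGroup 𝔥] [InnerProductSpace ℂ 𝔥] [CompleteSpace 𝔥]
  [FiniteDimensional ℂ 𝔥] {ι : Type*}

/-- The map `X ↦ A X A*`. -/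
noncomputable def conjMap (A : 𝔥 →L[ℂ] 𝔥) : (𝔥 →L[ℂ] 𝔥) →L[ℂ] (𝔥 →L[ℂ] 𝔥) :=
  ContinuousLinearMap.mulLeftRight ℂ (𝔥 →L[ℂ] 𝔥) A (ContinuousLinearMap.adjoint A)

@[simp]
theorem conjMap_apply (A X : 𝔥 →L[ℂ] 𝔥) :
    conjMap A X = A * X * ContinuousLinearMap.adjoint A := rfl

theorem conjMap_smul (a : ℂ) (A : 𝔥 →L[ℂ] 𝔥) :
    conjMap (a • A) = ((‖a‖ ^ 2 : ℝ) : ℂ) • conjMap A := by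
  ext1 X
  rw [smul_apply, conjMap_apply, conjMap_apply, map_smulₛₗ, smul_mul_assoc, smul_mul_assoc,
    mul_smul_comm, smul_smul, Complex.mul_conj']
  simp

theorem norm_conjMap_le (A : 𝔥 →L[ℂ] 𝔥) : ‖conjMap A‖ ≤ ‖A‖ ^ 2 := by
  refine (ContinuousLinearMap.opNorm_mulLeftRight_apply_apply_le ℂ _ _ _).trans ?_
  rw [LinearIsometryEquiv.norm_map, sq]

theorem isPositive_conjMap {A X : 𝔥 →L[ℂ] 𝔥} (hX : X.IsPositive) : (conjMap A X).IsPositive :=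
  hX.conj_adjoint A

theorem star_conjMap (A X : 𝔥 →L[ℂ] 𝔥) : star (conjMap A X) = conjMap A (star X) := by
  simp [← ContinuousLinearMap.star_eq_adjoint, mul_assoc]

theorem isPositive_of_hasSum {f : ι → 𝔥 →L[ℂ] 𝔥} {X : 𝔥 →L[ℂ] 𝔥} (h : HasSum f X)
    (hf : ∀ i, (f i).IsPositive) : X.IsPositive := by
  rw [← ContinuousLinearMap.nonneg_iff_isPositive]
  exact h.nonneg fun i => (ContinuousLinearMap.nonneg_iff_isPositive _).2 (hf i)

theorem hasSum_krausMap {A : ι → 𝔥 →L[ℂ] 𝔥} (hA : Summable fun k => ‖A k‖ ^ 2) :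
    HasSum (fun k => conjMap (A k)) (krausMap A) :=
  (Summable.of_norm_bounded hA fun k => norm_conjMap_le (A k)).hasSum

theorem hasSum_krausMap_apply {A : ι → 𝔥 →L[ℂ] 𝔥} (hA : Summable fun k => ‖A k‖ ^ 2)
    (X : 𝔥 →L[ℂ] 𝔥) : HasSum (fun k => conjMap (A k) X) (krausMap A X) :=
  (hasSum_krausMap hA).mapL (ContinuousLinearMap.apply ℂ _ X)

theorem isPositive_krausMap {A : ι → 𝔥 →L[ℂ] 𝔥} (hA : Summable fun k => ‖A k‖ ^ 2)
    {X : 𝔥 →L[ℂ] 𝔥} (hX : X.IsPositive) : (krausMap A X).IsPositive :=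
  isPositive_of_hasSum (hasSum_krausMap_apply hA X) fun _ => isPositive_conjMap hX

theorem star_krausMap {A : ι → 𝔥 →L[ℂ] 𝔥} (hA : Summable fun k => ‖A k‖ ^ 2)
    (X : 𝔥 →L[ℂ] 𝔥) : star (krausMap A X) = krausMap A (star X) := by
  have h1 := (hasSum_krausMap_apply hA X).star
  simp only [star_conjMap] at h1
  exact h1.unique (hasSum_krausMap_apply hA _)

theorem opTrace_krausMap {A : ι → 𝔥 →L[ℂ] 𝔥} (hA : Summable fun k => ‖A k‖ ^ 2)
    (h1 : HasSum (fun k => ContinuousLinearMap.adjoint (A k) * A k) 1) (X : 𝔥 →L[ℂ] 𝔥) :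
    opTrace (krausMap A X) = opTrace X := by
  have h2 := (hasSum_krausMap_apply hA X).mapL opTraceL
  have h3 := h1.mapL (opTraceL ∘L ContinuousLinearMap.mul ℂ (𝔥 →L[ℂ] 𝔥) X)
  simp only [ContinuousLinearMap.comp_apply, ContinuousLinearMap.mul_apply', mul_one,
    opTraceL_apply] at h3
  refine h2.unique ?_
  convert! h3 using 2 with k
  rw [opTraceL_apply, conjMap_apply, mul_assoc, opTrace_mul_comm, mul_assoc]

/-- A positivity preserving and trace preserving map has an invariant state. -/
theorem exists_isInvariantState [Nontrivial 𝔥] (T : (𝔥 →L[ℂ] 𝔥) →L[ℂ] (𝔥 →L[ℂ] 𝔥))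
    (hT : ∀ X, X.IsPositive → (T X).IsPositive) (hτ : ∀ X, opTrace (T X) = opTrace X) :
    ∃ σ, IsInvariantState T σ := by
  let D : Set (𝔥 →L[ℂ] 𝔥) := {X | 0 ≤ X ∧ opTraceL X = 1}
  have hD1 : ∀ X ∈ D, ‖X‖ ≤ 1 := fun X hX => by
    have := norm_le_re_opTrace ((ContinuousLinearMap.nonneg_iff_isPositive _).1 hX.1)
    rwa [← opTraceL_apply, hX.2, Complex.one_re] at this
  have hDc : IsCompact D := by
    have : ProperSpace (𝔥 →L[ℂ] 𝔥) := FiniteDimensional.proper ℂ _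
    refine Metric.isCompact_of_isClosed_isBounded ?_ ?_
    · exact (isClosed_Ici (a := (0 : 𝔥 →L[ℂ] 𝔥))).inter
        (isClosed_singleton.preimage opTraceL.continuous)
    · exact isBounded_iff_forall_norm_le.2 ⟨1, hD1⟩
  have hTD : ∀ X ∈ D, T X ∈ D := fun X hX =>
    ⟨(ContinuousLinearMap.nonneg_iff_isPositive _).2
      (hT _ ((ContinuousLinearMap.nonneg_iff_isPositive _).1 hX.1)), by
      rw [opTraceL_apply, hτ, ← opTraceL_apply, hX.2]⟩
  have hDconv : Convex ℝ D := by
    intro X hX Y hY a b ha hb hab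
    refine ⟨add_nonneg (smul_nonneg ha hX.1) (smul_nonneg hb hY.1), ?_⟩
    rw [map_add, ← Complex.coe_smul, ← Complex.coe_smul, map_smul, map_smul, hX.2, hY.2]
    simp [← Complex.ofReal_add, hab]
  obtain ⟨X₀, hX₀⟩ : ∃ X₀, X₀ ∈ D := by
    have hn : (0 : ℝ) < Module.finrank ℂ 𝔥 := by exact_mod_cast Module.finrank_pos
    refine ⟨((Module.finrank ℂ 𝔥 : ℝ)⁻¹ : ℝ) • 1, smul_nonneg (by positivity) ?_, ?_⟩
    · exact (ContinuousLinearMap.nonneg_iff_isPositive _).2 ContinuousLinearMap.isPositive_one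
    · rw [← Complex.coe_smul, map_smul, opTraceL_apply, opTrace_eq_sum_inner]
      have hn' : (Module.finrank ℂ 𝔥 : ℂ) ≠ 0 := by exact_mod_cast hn.ne'
      simp [hn']
  have hiter : ∀ n, (T^[n]) X₀ ∈ D := by
    intro n
    induction n with
    | zero => exact hX₀
    | succ n ih =>
      rw [Function.iterate_succ_apply']
      exact hTD _ ih
  -- Cesàro means of an orbit in the compact convex set `D` of states: they are almost invariant by
  -- telescoping, so every limit point is invariant.
  let c : ℕ → 𝔥 →L[ℂ] 𝔥 := fun n => ∑ k ∈ Finset.range (n + 1), ((n + 1 : ℝ)⁻¹) • (T^[k]) X₀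
  have hc : ∀ n, c n ∈ D := fun n => by
    refine hDconv.sum_mem (fun _ _ => by positivity) ?_ fun k _ => hiter k
    simp
    field_simp
  have hdiff : ∀ n, ‖T (c n) - c n‖ ≤ 2 * ((n : ℝ) + 1)⁻¹ := fun n => by
    have : T (c n) - c n = ((n + 1 : ℝ)⁻¹) • ((T^[n + 1]) X₀ - X₀) := by
      simp only [c, ← Finset.smul_sum]
      rw [show ∀ Y, T (((n : ℝ) + 1)⁻¹ • Y) = ((n : ℝ) + 1)⁻¹ • T Y from fun Y => by
        rw [← Complex.coe_smul, map_smul, Complex.coe_smul], ← smul_sub, map_sum,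
        ← Finset.sum_sub_distrib]
      simp only [← Function.iterate_succ_apply' T]
      rw [Finset.sum_range_sub (fun k => (T^[k]) X₀)]
      simp
    rw [this, norm_smul, Real.norm_of_nonneg (by positivity), mul_comm]
    refine mul_le_mul_of_nonneg_right ?_ (by positivity)
    exact (norm_sub_le _ _).trans (by linarith [hD1 _ (hiter (n + 1)), hD1 _ hX₀])
  obtain ⟨σ, hσ, φ, hφ, hlim⟩ := hDc.tendsto_subseq hc
  refine ⟨σ, (ContinuousLinearMap.nonneg_iff_isPositive _).1 hσ.1, hσ.2, ?_⟩
  have h1 : Tendsto (fun n => T (c (φ n)) - c (φ n)) atTop (𝓝 (T σ - σ)) :=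
    ((T.continuous.tendsto σ).comp hlim).sub hlim
  have h2 : Tendsto (fun n => T (c (φ n)) - c (φ n)) atTop (𝓝 0) := by
    refine (squeeze_zero_norm hdiff ?_).comp hφ.tendsto_atTop
    have := tendsto_one_div_add_atTop_nhds_zero_nat (𝕜 := ℝ)
    simpa using this.const_mul 2
  exact sub_eq_zero.1 (tendsto_nhds_unique h1 h2)

/-- Writing `σ = ∑ |uᵢ⟩⟨uᵢ|` gives `⟨x, σ x⟩ = ∑ |⟨uᵢ, x⟩|²`, so each `⟨uᵢ, x⟩` vanishes. -/
theorem apply_eq_zero_of_inner_eq_zero {σ : 𝔥 →L[ℂ] 𝔥} (hσ : σ.IsPositive) {x : 𝔥}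
    (hx : (⟪x, σ x⟫_ℂ).re = 0) : σ x = 0 := by
  obtain ⟨m, u, hu⟩ := ContinuousLinearMap.isPositive_iff_eq_sum_rankOne.1 hσ
  have h1 : (⟪x, σ x⟫_ℂ).re = ∑ i, ‖⟪u i, x⟫_ℂ‖ ^ 2 := by
    rw [hu]
    simp only [sum_apply, inner_sum, Complex.re_sum]
    refine Finset.sum_congr rfl fun i _ => ?_
    rw [InnerProductSpace.rankOne_apply, inner_smul_right, ← inner_conj_symm x (u i),
      Complex.mul_conj']
    norm_cast
  rw [hx, eq_comm, Finset.sum_eq_zero_iff_of_nonneg (fun _ _ => by positivity)] at h1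
  rw [hu, sum_apply]
  refine Finset.sum_eq_zero fun i hi => ?_
  rw [InnerProductSpace.rankOne_apply, norm_eq_zero.1 (pow_eq_zero_iff two_ne_zero |>.1 (h1 i hi)),
    zero_smul]

/-- Invariant states of an irreducible map are faithful. -/
theorem IsInvariantState.ker_eq_bot {A : ι → 𝔥 →L[ℂ] 𝔥} (hA : Summable fun k => ‖A k‖ ^ 2)
    (hirr : IsIrreducibleMap (krausMap A)) {σ : 𝔥 →L[ℂ] 𝔥} (hσ : IsInvariantState (krausMap A) σ) :
    σ.toLinearMap.ker = ⊥ := by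
  obtain ⟨hpos, htr, hinv⟩ := hσ
  let K : Submodule ℂ 𝔥 := σ.toLinearMap.ker
  have hK : ∀ {x}, x ∈ K ↔ σ x = 0 := Iff.rfl
  -- For `x` in the kernel, invariance gives `0 = ⟨x, σ x⟩ = ∑ₖ ⟨Aₖ* x, σ Aₖ* x⟩` with nonnegative
  -- terms, so each one vanishes.
  have hAK : ∀ k, ∀ x ∈ K, ContinuousLinearMap.adjoint (A k) x ∈ K := by
    intro k x hx
    have h1 := (hasSum_krausMap_apply hA σ).mapL
      (Complex.reCLM ∘L ((innerSL ℂ x ∘L ContinuousLinearMap.apply ℂ 𝔥 x).restrictScalars ℝ))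
    rw [hinv] at h1
    have hterm : ∀ k, (⟪x, conjMap (A k) σ x⟫_ℂ).re = (⟪ContinuousLinearMap.adjoint (A k) x,
        σ (ContinuousLinearMap.adjoint (A k) x)⟫_ℂ).re := fun k => by
      rw [ContinuousLinearMap.adjoint_inner_left]
      rfl
    have h2 : HasSum (fun k => (⟪ContinuousLinearMap.adjoint (A k) x,
        σ (ContinuousLinearMap.adjoint (A k) x)⟫_ℂ).re) 0 := by
      convert! h1 using 1
      · funext k
        exact (hterm k).symm
      · simp [hK.1 hx]
    have h3 := (hasSum_zero_iff_of_nonneg fun k => hpos.re_inner_nonneg_right _).1 h2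
    exact apply_eq_zero_of_inner_eq_zero hpos (congrFun h3 k)
  let Q : 𝔥 →L[ℂ] 𝔥 := K.starProjection
  have hQ : IsStarProjection Q := isStarProjection_starProjection
  have hQA : ∀ k, Q * A k * Q = Q * A k := fun k => by
    have h1 : Q * ContinuousLinearMap.adjoint (A k) * Q = ContinuousLinearMap.adjoint (A k) * Q := by
      ext x
      exact Submodule.starProjection_eq_self_iff.2
        (hAK k _ (Submodule.starProjection_apply_mem K x))
    have h2 := congrArg star h1
    simpa [← ContinuousLinearMap.star_eq_adjoint, hQ.isSelfAdjoint.star_eq, mul_assoc] using h2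
  have hP : IsStarProjection (1 - Q) := hQ.one_sub
  -- Taking adjoints, the orthogonal complement of the kernel is stable under every `A k`. Hence `1
  -- - Q` is a projection to which irreducibility applies.
  have hPA : ∀ k, (1 - Q) * A k * (1 - Q) = A k * (1 - Q) := fun k => by
    have := hQA k
    simp only [mul_sub, sub_mul, mul_one, one_mul, this]
    abel
  have hPA' : ∀ k, (1 - Q) * ContinuousLinearMap.adjoint (A k) * (1 - Q) =
      (1 - Q) * ContinuousLinearMap.adjoint (A k) := fun k => by
    have h2 := congrArg star (hPA k)
    rw [star_mul, star_mul, star_mul, hP.isSelfAdjoint.star_eq,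
      ContinuousLinearMap.star_eq_adjoint, ← mul_assoc] at h2
    exact h2
  have hinvP : ∀ X, krausMap A ((1 - Q) * X * (1 - Q)) =
      (1 - Q) * krausMap A ((1 - Q) * X * (1 - Q)) * (1 - Q) := fun X => by
    have h1 := hasSum_krausMap_apply hA ((1 - Q) * X * (1 - Q))
    have h2 := (h1.mul_left (1 - Q)).mul_right (1 - Q)
    refine h1.unique ?_
    convert! h2 using 2 with k
    calc A k * ((1 - Q) * X * (1 - Q)) * ContinuousLinearMap.adjoint (A k)
        = (A k * (1 - Q)) * X * ((1 - Q) * ContinuousLinearMap.adjoint (A k)) := by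
          simp only [mul_assoc]
      _ = ((1 - Q) * A k * (1 - Q)) * X *
          ((1 - Q) * ContinuousLinearMap.adjoint (A k) * (1 - Q)) := by rw [hPA, hPA']
      _ = _ := by simp only [conjMap_apply, mul_assoc]
  rcases hirr (1 - Q) hP fun X => ⟨krausMap A ((1 - Q) * X * (1 - Q)), hinvP X⟩ with h | h
  · exfalso
    have : σ = 0 := by
      ext x
      have h1 : Q = 1 := (sub_eq_zero.1 h).symm
      have h2 : Q x ∈ K := Submodule.starProjection_apply_mem K x
      rw [h1] at h2
      exact hK.1 h2
    rw [this] at htr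
    simp at htr
  · rw [Submodule.eq_bot_iff]
    intro x hx
    have h1 : Q = 0 := by simpa using h
    have h2 : Q x = x := Submodule.starProjection_eq_self_iff.2 hx
    rw [← h2, h1]
    rfl

theorem neg_smul_one_le {Z : 𝔥 →L[ℂ] 𝔥} (hZ : IsSelfAdjoint Z) {r : ℝ} (hr : ‖Z‖ ≤ r) :
    -(r • (1 : 𝔥 →L[ℂ] 𝔥)) ≤ Z := by
  have h1 := hZ.neg_algebraMap_norm_le_self
  rw [Algebra.algebraMap_eq_smul_one] at h1
  have h2 : (0 : 𝔥 →L[ℂ] 𝔥) ≤ 1 :=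
    (ContinuousLinearMap.nonneg_iff_isPositive _).2 ContinuousLinearMap.isPositive_one
  exact (neg_le_neg (smul_le_smul_of_nonneg_right hr h2)).trans h1

/-- A faithful state in finite dimension has strictly positive least eigenvalue; invariant states
are thus interior points of the positive cone. -/
theorem IsInvariantState.exists_pos_smul_one_le {A : ι → 𝔥 →L[ℂ] 𝔥}
    (hA : Summable fun k => ‖A k‖ ^ 2) (hirr : IsIrreducibleMap (krausMap A))
    {σ : 𝔥 →L[ℂ] 𝔥} (hσ : IsInvariantState (krausMap A) σ) :
    ∃ r : ℝ, 0 < r ∧ r • (1 : 𝔥 →L[ℂ] 𝔥) ≤ σ := by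
  have hinj : Function.Injective σ.toLinearMap := LinearMap.ker_eq_bot.1 (hσ.ker_eq_bot hA hirr)
  have hu : IsUnit σ := ContinuousLinearMap.isUnit_iff_bijective.2
    ⟨hinj, LinearMap.injective_iff_surjective.1 hinj⟩
  have hs : IsStrictlyPositive σ :=
    hu.isStrictlyPositive ((ContinuousLinearMap.nonneg_iff_isPositive _).2 hσ.1)
  have : Nontrivial (𝔥 →L[ℂ] 𝔥) := by
    by_contra h
    rw [not_nontrivial_iff_subsingleton] at h
    have h1 := hσ.2.1
    rw [Subsingleton.elim σ 0, map_zero] at h1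
    exact zero_ne_one h1
  simpa only [Algebra.algebraMap_eq_smul_one] using
    (CFC.exists_pos_algebraMap_le_iff hs.isSelfAdjoint).2 fun x hx => hs.spectrum_pos hx

/-- A self-adjoint fixed point of trace zero of an irreducible map vanishes. -/
theorem eq_zero_of_isSelfAdjoint_of_fixed {A : ι → 𝔥 →L[ℂ] 𝔥}
    (hA : Summable fun k => ‖A k‖ ^ 2) (hirr : IsIrreducibleMap (krausMap A))
    {σ : 𝔥 →L[ℂ] 𝔥} (hσ : IsInvariantState (krausMap A) σ) {Y : 𝔥 →L[ℂ] 𝔥}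
    (hY : IsSelfAdjoint Y) (hfix : krausMap A Y = Y) (htr : opTrace Y = 0) : Y = 0 := by
  -- If `σ + t Y` is positive, it is an invariant state, hence interior to the cone. So `I` is open
  -- as well as closed, and `σ + t Y` is positive for every real `t`. Dividing by large `|t|` gives
  -- `Y ≥ 0` and `-Y ≥ 0`.
  let I : Set ℝ := {t | 0 ≤ σ + t • Y}
  have hclosed : IsClosed I := isClosed_Ici.preimage (by fun_prop : Continuous fun t : ℝ => σ + t • Y)
  have hopen : IsOpen I := by
    rw [Metric.isOpen_iff]
    intro t ht
    have hst : IsInvariantState (krausMap A) (σ + t • Y) := by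
      refine ⟨(ContinuousLinearMap.nonneg_iff_isPositive _).1 ht, ?_, ?_⟩
      · rw [map_add, ← Complex.coe_smul, map_smul, htr, hσ.2.1, smul_zero, add_zero]
      · rw [map_add, ← Complex.coe_smul, map_smul, hfix, hσ.2.2]
    obtain ⟨r, hr, hle⟩ := hst.exists_pos_smul_one_le hA hirr
    refine ⟨r / (‖Y‖ + 1), by positivity, fun s hs => ?_⟩
    have hs' : |s - t| * ‖Y‖ ≤ r := by
      rw [Metric.mem_ball, Real.dist_eq, lt_div_iff₀ (by positivity)] at hs
      nlinarith [abs_nonneg (s - t)]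
    have hsa : IsSelfAdjoint ((s - t) • Y) := by
      rw [IsSelfAdjoint, star_smul, hY.star_eq, star_trivial]
    have h1 := neg_smul_one_le (r := r) hsa (by rwa [norm_smul, Real.norm_eq_abs])
    have h3 : σ + s • Y = (σ + t • Y) + (s - t) • Y := by
      rw [sub_smul]
      abel
    change 0 ≤ σ + s • Y
    rw [h3]
    simpa using add_le_add hle h1
  have hI : I = Set.univ := IsClopen.eq_univ ⟨hclosed, hopen⟩
    ⟨0, by simpa [I] using (ContinuousLinearMap.nonneg_iff_isPositive _).2 hσ.1⟩
  have hnonneg : ∀ ε : ℝ, 0 ≤ ε • Y ∨ ε = 0 := by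
    intro ε
    by_cases hε : ε = 0
    · exact Or.inr hε
    left
    have h1 : Tendsto (fun n : ℕ => (1 / ((n : ℝ) + 1)) • σ + ε • Y) atTop (𝓝 ((0 : ℝ) • σ + ε • Y)) :=
      (tendsto_one_div_add_atTop_nhds_zero_nat.smul_const σ).add_const _
    rw [zero_smul, zero_add] at h1
    refine ge_of_tendsto' h1 fun n => ?_
    have h2 : ((n : ℝ) + 1) * ε ∈ I := hI ▸ Set.mem_univ _
    have h3 := smul_nonneg (show 0 ≤ 1 / ((n : ℝ) + 1) by positivity) (show 0 ≤ σ + _ • Y from h2)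
    rw [smul_add, smul_smul] at h3
    convert h3 using 3
    field_simp
  refine le_antisymm ?_ ?_
  · simpa using (hnonneg (-1)).resolve_right (by norm_num)
  · simpa using (hnonneg 1).resolve_right (by norm_num)

/-- A fixed point of trace zero of an irreducible map vanishes. -/
theorem eq_zero_of_fixed {A : ι → 𝔥 →L[ℂ] 𝔥}
    (hA : Summable fun k => ‖A k‖ ^ 2) (hirr : IsIrreducibleMap (krausMap A))
    {σ : 𝔥 →L[ℂ] 𝔥} (hσ : IsInvariantState (krausMap A) σ) {Y : 𝔥 →L[ℂ] 𝔥}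
    (hfix : krausMap A Y = Y) (htr : opTrace Y = 0) : Y = 0 := by
  have hs : krausMap A (star Y) = star Y := by rw [← star_krausMap hA, hfix]
  have hst : opTrace (star Y) = 0 := by rw [opTrace_star, htr, star_zero]
  have h1 : Y + star Y = 0 := eq_zero_of_isSelfAdjoint_of_fixed hA hirr hσ
    (IsSelfAdjoint.add_star_self Y) (by rw [map_add, hfix, hs]) (by rw [map_add, htr, hst, add_zero])
  have h2 : Complex.I • (Y - star Y) = 0 := by
    refine eq_zero_of_isSelfAdjoint_of_fixed hA hirr hσ ?_ (by rw [map_smul, map_sub, hfix, hs])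
      (by rw [map_smul, map_sub, htr, hst, sub_zero, smul_zero])
    rw [IsSelfAdjoint, star_smul, star_sub, star_star]
    simp [← smul_neg]
  have h3 := (smul_eq_zero.1 h2).resolve_left Complex.I_ne_zero
  have h4 : (2 : ℂ) • Y = (Y + star Y) + (Y - star Y) := by
    rw [two_smul]
    abel
  rw [h1, h3, add_zero] at h4
  exact (smul_eq_zero.1 h4).resolve_left two_ne_zero

theorem IsInvariantState.unique {A : ι → 𝔥 →L[ℂ] 𝔥}
    (hA : Summable fun k => ‖A k‖ ^ 2) (hirr : IsIrreducibleMap (krausMap A))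
    {σ σ' : 𝔥 →L[ℂ] 𝔥} (hσ : IsInvariantState (krausMap A) σ)
    (hσ' : IsInvariantState (krausMap A) σ') : σ' = σ :=
  sub_eq_zero.1 <| eq_zero_of_fixed hA hirr hσ (by rw [map_sub, hσ.2.2, hσ'.2.2])
    (by rw [map_sub, hσ.2.1, hσ'.2.1, sub_self])

end Kraus

/-! ### The deformed maps with complex parameter -/

namespace OQRW

open scoped InnerProductSpace

variable {d : ℕ} {𝔥 : Type*} [NormedAddCommGroup 𝔥] [InnerProductSpace ℂ 𝔥]
  [CompleteSpace 𝔥] [FiniteDimensional ℂ 𝔥]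

/-- The complexification of a real vector. -/
noncomputable def toComplex : EuclideanSpace ℝ (Fin d) →L[ℝ] (Fin d → ℂ) :=
  ContinuousLinearMap.pi fun j => Complex.ofRealCLM ∘L EuclideanSpace.proj j

@[simp]
theorem toComplex_apply (u : EuclideanSpace ℝ (Fin d)) (j : Fin d) :
    toComplex u j = (u j : ℂ) := rfl

/-- The complex linear form `z ↦ ∑ⱼ sⱼ zⱼ`. -/
noncomputable def linForm (s : EuclideanSpace ℝ (Fin d)) : (Fin d → ℂ) →L[ℂ] ℂ :=
  ∑ j, (s j : ℂ) • ContinuousLinearMap.proj j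

theorem linForm_apply (s : EuclideanSpace ℝ (Fin d)) (z : Fin d → ℂ) :
    linForm s z = ∑ j, (s j : ℂ) * z j := by
  simp [linForm]

theorem linForm_toComplex (s u : EuclideanSpace ℝ (Fin d)) :
    linForm s (toComplex u) = ((⟪u, s⟫_ℝ : ℝ) : ℂ) := by
  simp [linForm_apply, PiLp.inner_apply]

theorem norm_linForm_le (s : EuclideanSpace ℝ (Fin d)) : ‖linForm s‖ ≤ ∑ j, |s j| := by
  refine ContinuousLinearMap.opNorm_le_bound _ (Finset.sum_nonneg fun _ _ => abs_nonneg _)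
    fun z => ?_
  rw [linForm_apply, Finset.sum_mul]
  refine (norm_sum_le _ _).trans (Finset.sum_le_sum fun j _ => ?_)
  rw [norm_mul, Complex.norm_real, Real.norm_eq_abs]
  exact mul_le_mul_of_nonneg_left (norm_le_pi_norm z j) (abs_nonneg _)

/-- The hypothesis controls one direction `u` at a time. An exponential of `∑ⱼ |sⱼ|` is nevertheless
at most the sum of the exponentials `exp ⟨e ε, s⟩` over the finitely many sign vectors, since one of
them matches the signs of `s`. -/
theorem summable_exp_norm_linForm {W : OQRW d 𝔥} (hW : W.DeformationsConverge) (r : ℝ) :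
    Summable fun s : W.V =>
      Real.exp (r * ‖linForm (s : EuclideanSpace ℝ (Fin d))‖) * ‖conjMap (W.L s)‖ := by
  let e : (Fin d → Bool) → EuclideanSpace ℝ (Fin d) := fun ε =>
    WithLp.toLp 2 fun j => if ε j then |r| else -|r|
  have h1 : Summable fun s : W.V => ∑ ε : Fin d → Bool,
      Real.exp (⟪e ε, (s : EuclideanSpace ℝ (Fin d))⟫_ℝ) * ‖W.L s‖ ^ 2 :=
    summable_sum fun ε _ => hW (e ε)
  refine Summable.of_nonneg_of_le (fun s => by positivity) (fun s => ?_) h1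
  let ε : Fin d → Bool := fun j => decide (0 ≤ (s : EuclideanSpace ℝ (Fin d)) j)
  have h2 : r * ‖linForm (s : EuclideanSpace ℝ (Fin d))‖ ≤
      ⟪e ε, (s : EuclideanSpace ℝ (Fin d))⟫_ℝ := by
    have h3 : ⟪e ε, (s : EuclideanSpace ℝ (Fin d))⟫_ℝ =
        |r| * ∑ j, |(s : EuclideanSpace ℝ (Fin d)) j| := by
      rw [PiLp.inner_apply, Finset.mul_sum]
      refine Finset.sum_congr rfl fun j _ => ?_
      simp only [e, ε, decide_eq_true_eq]
      split_ifs with hj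
      · rw [abs_of_nonneg hj]
        simp [mul_comm]
      · rw [abs_of_neg (not_le.1 hj)]
        simp [mul_comm]
    rw [h3]
    exact mul_le_mul (le_abs_self r) (norm_linForm_le _) (norm_nonneg _) (abs_nonneg _)
  calc _ ≤ Real.exp (⟪e ε, (s : EuclideanSpace ℝ (Fin d))⟫_ℝ) * ‖W.L s‖ ^ 2 := by
        gcongr
        exact norm_conjMap_le _
    _ ≤ _ := Finset.single_le_sum (f := fun ε => Real.exp (⟪e ε, (s : EuclideanSpace ℝ (Fin d))⟫_ℝ)
        * ‖W.L s‖ ^ 2) (fun _ _ => by positivity) (Finset.mem_univ ε)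

/-- The deformation `∑ₛ exp(⟨z, s⟩) Lₛ X Lₛ*` with complex parameter `z`. -/
noncomputable def cDeformed (W : OQRW d 𝔥) (z : Fin d → ℂ) : (𝔥 →L[ℂ] 𝔥) →L[ℂ] (𝔥 →L[ℂ] 𝔥) :=
  ∑' s : W.V, Complex.exp (linForm (s : EuclideanSpace ℝ (Fin d)) z) • conjMap (W.L s)

theorem auxDeformed_eq (W : OQRW d 𝔥) (u : EuclideanSpace ℝ (Fin d)) :
    W.auxDeformed u = W.cDeformed (toComplex u) := by
  refine tsum_congr fun s => ?_
  change conjMap _ = _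
  rw [conjMap_smul, linForm_toComplex, Complex.norm_real, Real.norm_of_nonneg (Real.exp_pos _).le,
    ← Real.exp_nat_mul, ← Complex.ofReal_exp]
  congr 3
  push_cast
  ring

theorem aux_eq (W : OQRW d 𝔥) : W.aux = W.cDeformed 0 :=
  tsum_congr fun s => by
    change conjMap _ = _
    simp

theorem summable_norm_sq {W : OQRW d 𝔥} (hW : W.DeformationsConverge) :
    Summable fun s => ‖W.L s‖ ^ 2 := by
  simpa using hW 0

theorem contDiff_cDeformed {W : OQRW d 𝔥} (hW : W.DeformationsConverge) :
    ContDiff ℂ 2 W.cDeformed :=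
  contDiff_two_tsum_exp_smul _ _ (summable_exp_norm_linForm hW)

theorem hasSum_cDeformed {W : OQRW d 𝔥} (hW : W.DeformationsConverge) (z : Fin d → ℂ)
    (X : 𝔥 →L[ℂ] 𝔥) :
    HasSum (fun s : W.V => Complex.exp (linForm (s : EuclideanSpace ℝ (Fin d)) z) •
      conjMap (W.L s) X) (W.cDeformed z X) := by
  have h1 : HasSum (fun s : W.V => Complex.exp (linForm (s : EuclideanSpace ℝ (Fin d)) z) •
      conjMap (W.L s)) (W.cDeformed z) := by
    refine (Summable.of_norm_bounded (summable_exp_norm_linForm hW ‖z‖) fun s => ?_).hasSum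
    rw [norm_smul, Complex.norm_exp]
    gcongr
    exact (Complex.re_le_norm _).trans ((ContinuousLinearMap.le_opNorm _ _).trans_eq (mul_comm _ _))
  exact h1.mapL (ContinuousLinearMap.apply ℂ _ X)

theorem isPositive_auxDeformed {W : OQRW d 𝔥} (hW : W.DeformationsConverge)
    (u : EuclideanSpace ℝ (Fin d)) {X : 𝔥 →L[ℂ] 𝔥} (hX : X.IsPositive) :
    (W.auxDeformed u X).IsPositive := by
  rw [auxDeformed_eq]
  refine isPositive_of_hasSum (hasSum_cDeformed hW _ X) fun s => ?_
  refine (isPositive_conjMap hX).smul_of_nonneg ?_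
  rw [linForm_toComplex, ← Complex.ofReal_exp]
  exact Complex.zero_le_real.2 (Real.exp_pos _).le

theorem star_auxDeformed {W : OQRW d 𝔥} (hW : W.DeformationsConverge)
    (u : EuclideanSpace ℝ (Fin d)) (X : 𝔥 →L[ℂ] 𝔥) :
    star (W.auxDeformed u X) = W.auxDeformed u (star X) := by
  rw [auxDeformed_eq]
  have h1 := (hasSum_cDeformed hW (toComplex u) X).star
  refine h1.unique ?_
  convert! hasSum_cDeformed hW (toComplex u) (star X) using 2 with s
  rw [star_smul, star_conjMap, linForm_toComplex, ← Complex.ofReal_exp,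
    Complex.star_def, Complex.conj_ofReal]

/-- The derivative of the deformation at `0`, applied to an operator and composed with the trace. -/
theorem hasSum_opTrace_fderiv_cDeformed {W : OQRW d 𝔥} (hW : W.DeformationsConverge)
    (z : Fin d → ℂ) (X : 𝔥 →L[ℂ] 𝔥) :
    HasSum (fun s : W.V => linForm (s : EuclideanSpace ℝ (Fin d)) z * opTrace (conjMap (W.L s) X))
      (opTrace (fderiv ℂ W.cDeformed 0 z X)) := by
  have h1 : HasSum (fun s : W.V => linForm (s : EuclideanSpace ℝ (Fin d)) z • conjMap (W.L s))
      (fderiv ℂ W.cDeformed 0 z) :=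
    hasSum_fderiv_tsum_exp_smul (fun s : W.V => linForm (s : EuclideanSpace ℝ (Fin d)))
      (fun s => conjMap (W.L s)) (summable_exp_norm_linForm hW) z
  let φ : ((𝔥 →L[ℂ] 𝔥) →L[ℂ] (𝔥 →L[ℂ] 𝔥)) →L[ℂ] ℂ :=
    opTraceL ∘L ContinuousLinearMap.apply ℂ (𝔥 →L[ℂ] 𝔥) X
  have h2 : ∀ Ψ, φ Ψ = opTrace (Ψ X) := fun _ => rfl
  have h3 := h1.mapL φ
  simpa only [h2, smul_apply, map_smul, smul_eq_mul] using h3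

end OQRW

/-! ### Path expansion and the Fourier transform of the position -/

namespace OQRW

open scoped InnerProductSpace

variable {d : ℕ} {𝔥 : Type*} [NormedAddCommGroup 𝔥] [InnerProductSpace ℂ 𝔥]
  [CompleteSpace 𝔥] [FiniteDimensional ℂ 𝔥]

/-- A trajectory that extends a finite path. -/
def extendPath {V : Type*} {n : ℕ} (h : Fin (n + 1) → V) (k : ℕ) : V :=
  h ⟨min k n, Nat.lt_succ_of_le (min_le_right k n)⟩

theorem extendPath_snoc {V : Type*} {n : ℕ} (h : Fin (n + 1) → V) (v : V) {k : ℕ} (hk : k ≤ n) :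
    extendPath (Fin.snoc h v : Fin (n + 2) → V) k = extendPath h k := by
  have h1 : (⟨min k (n + 1), Nat.lt_succ_of_le (min_le_right k (n + 1))⟩ : Fin (n + 2)) =
      Fin.castSucc ⟨min k n, Nat.lt_succ_of_le (min_le_right k n)⟩ := by
    ext
    simp
    omega
  simp only [extendPath]
  rw [h1, Fin.snoc_castSucc]

theorem extendPath_snoc_last {V : Type*} {n : ℕ} (h : Fin (n + 1) → V) (v : V) :
    extendPath (Fin.snoc h v : Fin (n + 2) → V) (n + 1) = v := by
  have h1 : (⟨min (n + 1) (n + 1), Nat.lt_succ_of_le (min_le_right (n + 1) (n + 1))⟩ :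
      Fin (n + 2)) = Fin.last (n + 1) := by
    ext
    simp
  simp only [extendPath]
  rw [h1, Fin.snoc_last]

theorem trajOp_snoc (W : OQRW d 𝔥) (ρ : W.DiagState) {n : ℕ} (h : Fin (n + 1) → W.V) (v : W.V) :
    W.trajOp ρ (extendPath (Fin.snoc h v : Fin (n + 2) → W.V)) (n + 1) =
      conjMap (W.L (v - extendPath h n)) (W.trajOp ρ (extendPath h) n) := by
  rw [trajOp, extendPath_snoc_last, extendPath_snoc h v le_rfl,
    W.trajOp_congr ρ n _ (extendPath h) fun k hk => extendPath_snoc h v hk]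
  rfl

/-- Paths of `n + 2` points as pairs of a path of `n + 1` points and an endpoint. -/
def snocEquiv (V : Type*) (n : ℕ) : (Fin (n + 1) → V) × V ≃ (Fin (n + 2) → V) where
  toFun p := Fin.snoc p.1 p.2
  invFun h := (Fin.init h, h (Fin.last _))
  left_inv p := by simp
  right_inv h := by simp

theorem norm_trajOp_le (W : OQRW d 𝔥) (ρ : W.DiagState) (x : ℕ → W.V) (n : ℕ) :
    ‖W.trajOp ρ x n‖ ≤ (opTrace (W.trajOp ρ x n)).re :=
  norm_le_re_opTrace (W.trajOp_isPositive ρ x n)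

/-- Summing over the last step preserves the trace. The path weights, of total mass `1`, also serve
as a summable majorant for the phased path sums. -/
theorem hasSum_re_opTrace_trajOp (W : OQRW d 𝔥) (ρ : W.DiagState) (n : ℕ) :
    HasSum (fun h : Fin (n + 1) → W.V => (opTrace (W.trajOp ρ (extendPath h) n)).re) 1 := by
  induction n with
  | zero =>
    rw [← (Equiv.funUnique (Fin 1) W.V).symm.hasSum_iff]
    exact Complex.hasSum_re ρ.hasSum_trace
  | succ n ih =>
    rw [← (snocEquiv W.V n).hasSum_iff]
    have hfib : ∀ h : Fin (n + 1) → W.V, HasSum (fun v : W.V =>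
        (opTrace (W.trajOp ρ (extendPath (Fin.snoc h v : Fin (n + 2) → W.V)) (n + 1))).re)
        (opTrace (W.trajOp ρ (extendPath h) n)).re := fun h => by
      simp only [trajOp_snoc]
      exact W.hasSum_step _ _
    have hs : Summable ((fun h : Fin (n + 2) → W.V =>
        (opTrace (W.trajOp ρ (extendPath h) (n + 1))).re) ∘ (snocEquiv W.V n)) := by
      refine (summable_prod_of_nonneg fun p => opTrace_re_nonneg (W.trajOp_isPositive _ _ _)).2
        ⟨fun h => (hfib h).summable, ?_⟩
      refine ih.summable.congr fun h => (hfib h).tsum_eq.symm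
    have h1 := hs.hasSum.prod_fiberwise (g := fun h =>
      (opTrace (W.trajOp ρ (extendPath h) n)).re) hfib
    rw [ih.unique h1]
    exact hs.hasSum

/-- The phase `exp(i⟨θ, v⟩)`. -/
noncomputable def phase (θ v : EuclideanSpace ℝ (Fin d)) : ℂ := Complex.exp (⟪θ, v⟫_ℝ * Complex.I)

theorem norm_phase (θ v : EuclideanSpace ℝ (Fin d)) : ‖phase θ v‖ = 1 :=
  Complex.norm_exp_ofReal_mul_I _

theorem phase_add (θ v w : EuclideanSpace ℝ (Fin d)) :
    phase θ (v + w) = phase θ v * phase θ w := by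
  simp only [phase, inner_add_right, Complex.ofReal_add, add_mul, Complex.exp_add]

/-- The Fourier transform of the initial state. -/
noncomputable def fourierState (W : OQRW d 𝔥) (ρ : W.DiagState) (θ : EuclideanSpace ℝ (Fin d)) :
    𝔥 →L[ℂ] 𝔥 :=
  ∑' v : W.V, phase θ v • ρ.block v

theorem summable_norm_block (W : OQRW d 𝔥) (ρ : W.DiagState) :
    Summable fun v => ‖ρ.block v‖ :=
  Summable.of_nonneg_of_le (fun _ => norm_nonneg _)
    (fun v => norm_le_re_opTrace (ρ.isPositive v)) (Complex.hasSum_re ρ.hasSum_trace).summable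

theorem summable_norm_trajOp (W : OQRW d 𝔥) (ρ : W.DiagState) (n : ℕ) :
    Summable fun h : Fin (n + 1) → W.V => ‖W.trajOp ρ (extendPath h) n‖ :=
  Summable.of_nonneg_of_le (fun _ => norm_nonneg _)
    (fun _ => W.norm_trajOp_le ρ _ n) (W.hasSum_re_opTrace_trajOp ρ n).summable

theorem summable_phase_trajOp (W : OQRW d 𝔥) (ρ : W.DiagState) (n : ℕ)
    (θ : EuclideanSpace ℝ (Fin d)) :
    Summable fun h : Fin (n + 1) → W.V =>
      phase θ (extendPath h n : W.V) • W.trajOp ρ (extendPath h) n := by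
  refine Summable.of_norm ((W.summable_norm_trajOp ρ n).congr fun h => ?_)
  rw [norm_smul, norm_phase, one_mul]

/-- The phase is multiplicative along increments, so summing over the last step of a path amounts to
one application of the deformed map at `iθ`. -/
theorem hasSum_phase_trajOp {W : OQRW d 𝔥} (hW : W.DeformationsConverge) (ρ : W.DiagState) (n : ℕ)
    (θ : EuclideanSpace ℝ (Fin d)) :
    HasSum (fun h : Fin (n + 1) → W.V =>
      phase θ (extendPath h n : W.V) • W.trajOp ρ (extendPath h) n)
      ((W.cDeformed (Complex.I • toComplex θ) ^ n) (W.fourierState ρ θ)) := by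
  induction n with
  | zero =>
    have h0 : Summable fun v : W.V => phase θ v • ρ.block v := by
      refine Summable.of_norm ((W.summable_norm_block ρ).congr fun _ => ?_)
      rw [norm_smul, norm_phase, one_mul]
    rw [← (Equiv.funUnique (Fin 1) W.V).symm.hasSum_iff]
    exact h0.hasSum
  | succ n ih =>
    have hs := W.summable_phase_trajOp ρ (n + 1) θ
    rw [← (snocEquiv W.V n).summable_iff] at hs
    rw [← (snocEquiv W.V n).hasSum_iff]
    have hfib : ∀ h : Fin (n + 1) → W.V, HasSum (fun v : W.V =>
        phase θ (extendPath (Fin.snoc h v : Fin (n + 2) → W.V) (n + 1) : W.V) •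
          W.trajOp ρ (extendPath (Fin.snoc h v : Fin (n + 2) → W.V)) (n + 1))
        (W.cDeformed (Complex.I • toComplex θ)
          (phase θ (extendPath h n : W.V) • W.trajOp ρ (extendPath h) n)) := fun h => by
      have h1 := (Equiv.subRight (extendPath h n)).hasSum_iff.2
        (hasSum_cDeformed hW (Complex.I • toComplex θ)
          (phase θ (extendPath h n : W.V) • W.trajOp ρ (extendPath h) n))
      convert! h1 using 2 with v
      simp only [Function.comp, Equiv.subRight_apply]
      rw [trajOp_snoc, extendPath_snoc_last, map_smul, map_smul, smul_smul, linForm_toComplex]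
      congr 1
      rw [smul_eq_mul, mul_comm Complex.I]
      change _ = phase θ _ * _
      rw [← phase_add]
      congr 1
      simp
    have h1 := hs.hasSum.prod_fiberwise hfib
    have h2 := ih.mapL (W.cDeformed (Complex.I • toComplex θ))
    have h3 := h2.unique h1
    rw [pow_succ', mul_apply_eq_comp, h3]
    exact hs.hasSum

/-- Phases have modulus one, so the path expansion is dominated by the path probabilities. The bound
is uniform in `n` and `θ`, and stands in for control of the remaining spectrum. -/
theorem norm_cDeformed_pow_le {W : OQRW d 𝔥} (hW : W.DeformationsConverge) (ρ : W.DiagState)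
    (n : ℕ) (θ : EuclideanSpace ℝ (Fin d)) :
    ‖(W.cDeformed (Complex.I • toComplex θ) ^ n) (W.fourierState ρ θ)‖ ≤ 1 := by
  refine (hasSum_phase_trajOp hW ρ n θ).norm_le_of_bounded (W.hasSum_re_opTrace_trajOp ρ n)
    fun h => ?_
  rw [norm_smul, norm_phase, one_mul]
  exact W.norm_trajOp_le ρ _ n

theorem opTrace_fourierState_zero (W : OQRW d 𝔥) (ρ : W.DiagState) :
    opTrace (W.fourierState ρ 0) = 1 := by
  have h0 : HasSum (fun v : W.V => phase (0 : EuclideanSpace ℝ (Fin d)) v • ρ.block v) (W.fourierState ρ 0) := by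
    refine (Summable.of_norm ((W.summable_norm_block ρ).congr fun _ => ?_)).hasSum
    rw [norm_smul, norm_phase, one_mul]
  have h1 := h0.mapL opTraceL
  simp only [phase, inner_zero_left, Complex.ofReal_zero, zero_mul, Complex.exp_zero,
    one_smul, opTraceL_apply] at h1
  exact h1.unique ρ.hasSum_trace

theorem continuous_fourierState (W : OQRW d 𝔥) (ρ : W.DiagState) :
    Continuous (W.fourierState ρ) := by
  refine continuous_tsum (fun v => ?_) (W.summable_norm_block ρ) fun v θ => ?_
  · unfold phase
    fun_prop
  · rw [norm_smul, norm_phase, one_mul]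

theorem preimage_restrict_singleton {V : Type*} {n : ℕ} (h : Fin (n + 1) → V) :
    (fun (ω : ℕ → V) (k : Fin (n + 1)) => ω k) ⁻¹' {h} = TrajectoryLaw.cyl n (extendPath h) := by
  ext ω
  simp only [Set.mem_preimage, Set.mem_singleton_iff, TrajectoryLaw.cyl, Set.mem_ofPred_eq]
  constructor
  · rintro rfl k hk
    simp [extendPath, min_eq_left hk]
  · intro H
    funext k
    rw [H k (Nat.lt_succ_iff.1 k.2)]
    simp [extendPath, min_eq_left (Nat.lt_succ_iff.1 k.2)]

/-- The Fourier transform of the law of the position. -/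
theorem integral_phase_pos {W : OQRW d 𝔥} (hW : W.DeformationsConverge) (ρ : W.DiagState) (n : ℕ)
    (θ : EuclideanSpace ℝ (Fin d)) :
    ∫ ω, phase θ (W.pos n ω) ∂(W.law ρ) =
      opTrace ((W.cDeformed (Complex.I • toComplex θ) ^ n) (W.fourierState ρ θ)) := by
  let R : (ℕ → W.V) → (Fin (n + 1) → W.V) := fun ω k => ω k
  have hR : Measurable R := by fun_prop
  have h1 : ∫ ω, phase θ (W.pos n ω) ∂(W.law ρ) =
      ∫ h : Fin (n + 1) → W.V, phase θ (extendPath h n : W.V) ∂((W.law ρ).map R) := by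
    rw [integral_map hR.aemeasurable (Measurable.of_discrete.aestronglyMeasurable)]
    simp [R, extendPath, pos]
  have : IsProbabilityMeasure ((W.law ρ).map R) := Measure.isProbabilityMeasure_map hR.aemeasurable
  rw [h1, integral_countable ?_]
  · have h2 := (hasSum_phase_trajOp hW ρ n θ).mapL opTraceL
    rw [← opTraceL_apply, ← h2.tsum_eq]
    refine tsum_congr fun h => ?_
    rw [measureReal_def, Measure.map_apply hR (measurableSet_singleton _),
      preimage_restrict_singleton, law_cyl,
      ENNReal.toReal_ofReal (opTrace_re_nonneg (W.trajOp_isPositive _ _ _)), map_smul,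
      opTraceL_apply, opTrace_eq_re_of_isPositive (W.trajOp_isPositive ρ (extendPath h) n)]
    simp [mul_comm]
  · refine Integrable.of_bound (C := 1) Measurable.of_discrete.aestronglyMeasurable
      (Eventually.of_forall fun h => (norm_phase _ _).le)

end OQRW

/-! ### Holomorphic functions of one variable and the Gaussian limit -/

/-- The conclusion holds in a neighbourhood, not only at `0`, so that the lemma can be applied again
to `deriv φ` and `deriv h`. -/
theorem eventually_deriv_ofReal {h : ℂ → ℂ} (hh : AnalyticAt ℂ h 0) {φ : ℝ → ℝ}
    (hφ : ∀ᶠ t : ℝ in 𝓝 0, (φ t : ℂ) = h t) :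
    ∀ᶠ t : ℝ in 𝓝 0, HasDerivAt φ (deriv φ t) t ∧ ((deriv φ t : ℝ) : ℂ) = deriv h t := by
  have h1 : ∀ᶠ t : ℝ in 𝓝 0, DifferentiableAt ℂ h t := by
    have h2 := Complex.analyticAt_iff_eventually_differentiableAt.1 hh
    have h3 : Tendsto (fun t : ℝ => (t : ℂ)) (𝓝 0) (𝓝 0) := by
      simpa using Complex.continuous_ofReal.tendsto 0
    exact h3.eventually h2
  filter_upwards [hφ.eventually_nhds, h1] with t ht hd
  have hφ' : φ =ᶠ[𝓝 t] fun s : ℝ => (h s).re := by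
    filter_upwards [ht] with s hs
    rw [← hs, Complex.ofReal_re]
  have h4 : HasDerivAt φ (deriv h t).re t :=
    (HasDerivAt.real_of_complex hd.hasDerivAt).congr_of_eventuallyEq hφ'
  refine ⟨h4.differentiableAt.hasDerivAt, ?_⟩
  have h5 : HasDerivAt (fun s : ℝ => (φ s : ℂ)) (deriv h t) t :=
    (HasDerivAt.comp_ofReal hd.hasDerivAt).congr_of_eventuallyEq ht
  rw [h4.deriv]
  exact h4.ofReal_comp.unique h5

theorem isLittleO_sub_taylor_two {k : ℂ → ℂ} (hk : AnalyticAt ℂ k 0) (h0 : k 0 = 1)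
    (h1 : deriv k 0 = 0) :
    (fun z => k z - (1 + deriv (deriv k) 0 / 2 * z ^ 2)) =o[𝓝 0] fun z => z ^ 2 := by
  have h2 := hk.hasFPowerSeriesAt.isBigO_sub_partialSum_pow 3
  have h3 : (fun z : ℂ => ‖z‖ ^ 3) =o[𝓝 0] fun z : ℂ => z ^ 2 := by
    have h4 : (fun z : ℂ => z ^ 3) =o[𝓝 0] fun z : ℂ => z ^ 2 :=
      Asymptotics.isLittleO_pow_pow (by norm_num)
    simpa only [norm_pow] using h4.norm_left
  refine (h2.trans_isLittleO h3).congr_left fun z => ?_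
  simp only [zero_add, FormalMultilinearSeries.partialSum, Finset.sum_range_succ,
    Finset.sum_range_zero, FormalMultilinearSeries.ofScalars_apply_eq, iteratedDeriv_succ,
    iteratedDeriv_zero, h0, h1]
  simp [Nat.factorial]

/-- If `h` is analytic at `0` with `h 0 = 1`, then `(exp (-i a / √p) h (i / √p)) ^ p` with `a = h' 0`
converges to a Gaussian value. -/
theorem tendsto_pow_of_analyticAt {h : ℂ → ℂ} (hh : AnalyticAt ℂ h 0) (h0 : h 0 = 1) :
    Tendsto (fun p : ℕ => (Complex.exp (-(deriv h 0 * (Complex.I * ((√p)⁻¹ : ℝ)))) *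
      h (Complex.I * ((√p)⁻¹ : ℝ))) ^ p) atTop
      (𝓝 (Complex.exp (-(deriv (deriv h) 0 - deriv h 0 ^ 2) / 2))) := by
  let a := deriv h 0
  -- The exponential factor is the centring: it makes the first derivative at `0` vanish and turns
  -- the second into `h'' - h'²`.
  let k : ℂ → ℂ := fun z => Complex.exp (-(a * z)) * h z
  have hk : AnalyticAt ℂ k 0 := by
    refine AnalyticAt.mul ?_ hh
    fun_prop
  have hk0 : k 0 = 1 := by simp [k, h0]
  have hexp : ∀ z, HasDerivAt (fun z => Complex.exp (-(a * z))) (Complex.exp (-(a * z)) * -a) z :=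
    fun z => by simpa using ((hasDerivAt_id z).const_mul a).neg.cexp
  have hd : ∀ᶠ z in 𝓝 0, deriv k z = Complex.exp (-(a * z)) * (deriv h z - a * h z) := by
    filter_upwards [Complex.analyticAt_iff_eventually_differentiableAt.1 hh] with z hz
    refine ((hexp z).mul hz.hasDerivAt).deriv.trans ?_
    ring
  have hk1 : deriv k 0 = 0 := by simp [hd.self_of_nhds, h0, a]
  have hk2 : deriv (deriv k) 0 = deriv (deriv h) 0 - a ^ 2 := by
    rw [EventuallyEq.deriv_eq hd]
    have h2 := (hexp 0).mul (hh.deriv.differentiableAt.hasDerivAt.sub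
      (hh.differentiableAt.hasDerivAt.const_mul a))
    refine h2.deriv.trans ?_
    simp [h0, a]
    ring
  have ht := isLittleO_sub_taylor_two hk hk0 hk1
  rw [hk2] at ht
  have hz : Tendsto (fun p : ℕ => Complex.I * (((√p)⁻¹ : ℝ) : ℂ)) atTop (𝓝 0) := by
    have h3 : Tendsto (fun p : ℕ => (√(p : ℝ))⁻¹) atTop (𝓝 0) :=
      tendsto_inv_atTop_zero.comp (Real.tendsto_sqrt_atTop.comp tendsto_natCast_atTop_atTop)
    simpa using ((Complex.continuous_ofReal.tendsto 0).comp h3).const_mul Complex.I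
  have hsq : ∀ p : ℕ, (Complex.I * (((√p)⁻¹ : ℝ) : ℂ)) ^ 2 = -(1 / (p : ℂ)) := fun p => by
    rw [mul_pow, Complex.I_sq, ← Complex.ofReal_pow, inv_pow, Real.sq_sqrt (Nat.cast_nonneg p)]
    simp
  have ht2 := ht.comp_tendsto hz
  refine Complex.tendsto_pow_exp_of_isLittleO_sub_add_div _ ?_
  refine Asymptotics.IsLittleO.congr' (ht2.neg_right) (Eventually.of_forall fun p => ?_)
    (Eventually.of_forall fun p => ?_)
  · simp only [Function.comp, hsq]
    simp only [k, a]
    ring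
  · simp only [Function.comp, hsq, neg_neg]

/-! ### Second derivatives along lines -/

section Hessian

variable {E : Type*} [NormedAddCommGroup E] [NormedSpace ℝ E]

theorem iteratedDeriv_two_line {f : E → ℝ} (hf : ContDiffAt ℝ 2 f 0) (u : E) :
    iteratedDeriv 2 (fun t : ℝ => f (t • u)) 0 = fderiv ℝ (fderiv ℝ f) 0 u u := by
  have hline : ∀ t : ℝ, HasDerivAt (fun t : ℝ => t • u) u t := fun t => by
    simpa using (hasDerivAt_id t).smul_const u
  have ht : Tendsto (fun t : ℝ => t • u) (𝓝 0) (𝓝 0) := by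
    simpa using (hline 0).continuousAt.tendsto
  have h1 : ∀ᶠ t : ℝ in 𝓝 0, deriv (fun t : ℝ => f (t • u)) t = fderiv ℝ f (t • u) u := by
    have h2 : ∀ᶠ x in 𝓝 (0 : E), ContDiffAt ℝ 2 f x := hf.eventually (by norm_num)
    filter_upwards [ht.eventually h2] with t h3
    exact ((h3.differentiableAt (by norm_num)).hasFDerivAt.comp_hasDerivAt t (hline t)).deriv
  rw [iteratedDeriv_succ, iteratedDeriv_one, EventuallyEq.deriv_eq h1]
  have h4 : DifferentiableAt ℝ (fderiv ℝ f) 0 :=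
    (hf.fderiv_right (m := 1) (by norm_num)).differentiableAt (by norm_num)
  have h5 : HasFDerivAt (fderiv ℝ f) (fderiv ℝ (fderiv ℝ f) 0) ((0 : ℝ) • u) := by
    rw [zero_smul]
    exact h4.hasFDerivAt
  have h6 : HasDerivAt (fun t : ℝ => fderiv ℝ f (t • u)) (fderiv ℝ (fderiv ℝ f) 0 u) 0 :=
    h5.comp_hasDerivAt 0 (hline 0)
  have h7 := (ContinuousLinearMap.apply ℝ ℝ u).hasFDerivAt.comp_hasDerivAt (0 : ℝ) h6
  exact h7.deriv

theorem iteratedDeriv_two_log {φ : ℝ → ℝ} (h0 : φ 0 = 1)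
    (h1 : ∀ᶠ t in 𝓝 0, HasDerivAt φ (deriv φ t) t)
    (h2 : HasDerivAt (deriv φ) (deriv (deriv φ) 0) 0) :
    iteratedDeriv 2 (fun t => Real.log (φ t)) 0 = iteratedDeriv 2 φ 0 - deriv φ 0 ^ 2 := by
  have hne : ∀ᶠ t in 𝓝 0, φ t ≠ 0 :=
    h1.self_of_nhds.continuousAt.eventually_ne (by rw [h0]; exact one_ne_zero)
  have h3 : ∀ᶠ t in 𝓝 0, deriv (fun t => Real.log (φ t)) t = deriv φ t / φ t := by
    filter_upwards [h1, hne] with t ht hn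
    exact (ht.log hn).deriv
  rw [iteratedDeriv_succ, iteratedDeriv_one, EventuallyEq.deriv_eq h3,
    (h2.fun_div h1.self_of_nhds hne.self_of_nhds).deriv, h0, iteratedDeriv_succ, iteratedDeriv_one]
  ring

end Hessian

/-! ### The leading eigenvalue and the limit of characteristic functions -/

namespace OQRW

open scoped InnerProductSpace

variable {d : ℕ} {𝔥 : Type*} [NormedAddCommGroup 𝔥] [InnerProductSpace ℂ 𝔥]
  [CompleteSpace 𝔥] [FiniteDimensional ℂ 𝔥]

theorem nontrivial_of_diagState {W : OQRW d 𝔥} (ρ : W.DiagState) : Nontrivial 𝔥 := by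
  by_contra h
  rw [not_nontrivial_iff_subsingleton] at h
  have h1 : (fun i => opTrace (ρ.block i)) = fun _ => 0 := by
    funext i
    rw [Subsingleton.elim (ρ.block i) 0, map_zero]
  have h2 := ρ.hasSum_trace
  rw [h1] at h2
  exact zero_ne_one (hasSum_zero.unique h2)

theorem inner_drift {W : OQRW d 𝔥} (hW : W.DeformationsConverge) {σ : 𝔥 →L[ℂ] 𝔥}
    (hσ : σ.IsPositive) (u : EuclideanSpace ℝ (Fin d)) :
    ((⟪u, W.drift σ⟫_ℝ : ℝ) : ℂ) = opTrace (fderiv ℂ W.cDeformed 0 (toComplex u) σ) := by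
  have h1 : ∀ u : EuclideanSpace ℝ (Fin d), HasSum (fun s : W.V =>
      ((⟪u, (s : EuclideanSpace ℝ (Fin d))⟫_ℝ * (opTrace (conjMap (W.L s) σ)).re : ℝ) : ℂ))
      (opTrace (fderiv ℂ W.cDeformed 0 (toComplex u) σ)) := fun u => by
    convert! hasSum_opTrace_fderiv_cDeformed hW (toComplex u) σ using 2 with s
    rw [linForm_toComplex, opTrace_eq_re_of_isPositive (isPositive_conjMap hσ)]
    simp
  -- The series of `drift` is shown to converge coordinatewise first; without summability its `tsum`
  -- would be the default value `0`.
  let m : Fin d → ℝ := fun j =>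
    (opTrace (fderiv ℂ W.cDeformed 0 (toComplex (EuclideanSpace.single j 1)) σ)).re
  have h2 : HasSum (fun s : W.V => fun j : Fin d =>
      (opTrace (conjMap (W.L s) σ)).re * (s : EuclideanSpace ℝ (Fin d)) j) m := by
    refine Pi.hasSum.2 fun j => ?_
    convert! Complex.hasSum_re (h1 (EuclideanSpace.single j 1)) using 2 with s
    rw [Complex.ofReal_re, EuclideanSpace.inner_single_left]
    simp [mul_comm]
  have h3 : HasSum (fun s : W.V => (opTrace (conjMap (W.L s) σ)).re •
      (s : EuclideanSpace ℝ (Fin d))) (WithLp.toLp 2 m) :=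
    h2.mapL ((EuclideanSpace.equiv (Fin d) ℝ).symm : (Fin d → ℝ) →L[ℝ] EuclideanSpace ℝ (Fin d))
  have h4 := (h3.summable.hasSum.mapL (innerSL ℝ u)).mapL Complex.ofRealCLM
  refine HasSum.unique ?_ (h1 u)
  convert! h4 using 2 with s
  simp [mul_comm]

/-- The eigenvalue branch is pulled back along `z ↦ 𝔏_z`. The parameter is complex because the
spectral radius needs real arguments and the characteristic function imaginary ones. -/
theorem exists_perturbed_eigenvalue [Nontrivial 𝔥] {W : OQRW d 𝔥} (hW : W.DeformationsConverge)
    (hirr : IsIrreducibleMap W.aux) {σ : 𝔥 →L[ℂ] 𝔥} (hσ : IsInvariantState W.aux σ) :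
    ∃ (Λ : (Fin d → ℂ) → ℂ) (g : (Fin d → ℂ) → ((𝔥 →L[ℂ] 𝔥) →L[ℂ] ℂ)),
      ContDiffAt ℂ 2 Λ 0 ∧ Λ 0 = 1 ∧ ContinuousAt g 0 ∧ g 0 = opTraceL ∧
      (∀ᶠ z in 𝓝 0, g z ∘L W.cDeformed z = Λ z • g z) ∧
      (∀ᶠ u : EuclideanSpace ℝ (Fin d) in 𝓝 0, (W.lam u : ℂ) = Λ (toComplex u)) ∧
      ∀ u : EuclideanSpace ℝ (Fin d),
        fderiv ℂ Λ 0 (toComplex u) = ((⟪u, W.drift σ⟫_ℝ : ℝ) : ℂ) := by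
  have hA := summable_norm_sq hW
  have hker : ∀ X, W.cDeformed 0 X = X → opTraceL X = 0 → X = 0 := fun X hX h0 => by
    rw [← aux_eq] at hX
    exact eq_zero_of_fixed hA hirr hσ hX h0
  have hfix : W.cDeformed 0 σ = σ := by rw [← aux_eq, hσ.2.2]
  have hτ : opTraceL ∘L W.cDeformed 0 = opTraceL := by
    rw [← aux_eq]
    ext X
    exact opTrace_krausMap hA W.stochastic X
  obtain ⟨μ, g, hμ, hg, hμ0, hg0, heig, huniq, hder⟩ :=
    exists_eigenvalue_branch (W.cDeformed 0) opTraceL σ hfix hτ hσ.2.1 hker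
  have hcd := contDiff_cDeformed hW
  have hT : Tendsto W.cDeformed (𝓝 0) (𝓝 (W.cDeformed 0)) := hcd.continuous.tendsto 0
  have hTu : Tendsto (fun u => W.cDeformed (toComplex u)) (𝓝 0) (𝓝 (W.cDeformed 0)) := by
    have h1 : Tendsto (toComplex (d := d)) (𝓝 0) (𝓝 0) := by
      simpa using (toComplex (d := d)).continuous.tendsto 0
    exact hT.comp h1
  refine ⟨fun z => μ (W.cDeformed z), fun z => g (W.cDeformed z), hμ.comp 0 hcd.contDiffAt, hμ0,
    ContinuousAt.comp hg.continuousAt hcd.continuous.continuousAt, hg0,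
    (hT.eventually heig).mono fun z h => h.1, ?_, fun u => ?_⟩
  · have hgT : Tendsto (fun u => g (W.cDeformed (toComplex u))) (𝓝 0) (𝓝 opTraceL) := by
      rw [← hg0]
      exact hg.continuousAt.tendsto.comp hTu
    have hμT : Tendsto (fun u => μ (W.cDeformed (toComplex u))) (𝓝 0) (𝓝 1) := by
      rw [← hμ0]
      exact hμ.continuousAt.tendsto.comp hTu
    -- For real `u` the map commutes with the adjoint, so the conjugated pair is again a normalized
    -- eigenpair near `(Tr, 1)`. Local uniqueness then forces the eigenvalue to be real.
    have hv : Tendsto (fun u => (W.cDeformed (toComplex u),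
        conjDual (g (W.cDeformed (toComplex u))), star (μ (W.cDeformed (toComplex u)))))
        (𝓝 0) (𝓝 (W.cDeformed 0, opTraceL, (1 : ℂ))) := by
      refine hTu.prodMk_nhds (Tendsto.prodMk_nhds ?_ ?_)
      · have h1 := (continuous_conjDual.tendsto (opTraceL (𝔥 := 𝔥))).comp hgT
        rwa [conjDual_opTraceL] at h1
      · simpa using hμT.star
    have hclose : ∀ᶠ u in 𝓝 0, ‖g (W.cDeformed (toComplex u)) - opTraceL‖ ≤ 1 / 2 := by
      have h1 := (hgT.sub_const opTraceL).norm
      rw [sub_self, norm_zero] at h1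
      exact h1.eventually_le_const (by norm_num)
    have hre : ∀ᶠ u in 𝓝 0, 0 < (μ (W.cDeformed (toComplex u))).re :=
      ((Complex.continuous_re.tendsto 1).comp hμT).eventually_const_lt (by simp)
    filter_upwards [hv.eventually huniq, hTu.eventually heig, hclose, hre] with u h1 h2 h3 h4
    have hstar : ∀ X, star (W.cDeformed (toComplex u) X) = W.cDeformed (toComplex u) (star X) := by
      rw [← auxDeformed_eq]
      exact star_auxDeformed hW u
    have hreal : star (μ (W.cDeformed (toComplex u))) = μ (W.cDeformed (toComplex u)) := by
      refine h1 ?_ ?_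
      · ext X
        have h5 := congrArg (fun φ : (𝔥 →L[ℂ] 𝔥) →L[ℂ] ℂ => φ (star X)) h2.1
        simp only [ContinuousLinearMap.comp_apply, smul_apply, smul_eq_mul] at h5
        simp only [ContinuousLinearMap.comp_apply, smul_apply, smul_eq_mul, conjDual_apply, hstar,
          h5, star_mul']
      · rw [conjDual_apply, hσ.1.isSelfAdjoint.star_eq, h2.2, star_one]
    have hsr := spectralRadius_eq_of_left_eigenvector (W.cDeformed (toComplex u))
      (fun X hX => by
        rw [← auxDeformed_eq]
        exact isPositive_auxDeformed hW u hX) _ h3 _ h2.1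
    rw [lam, auxDeformed_eq, hsr, ENNReal.coe_toReal, coe_nnnorm]
    have h6 := Complex.conj_eq_iff_re.1 hreal
    rw [← h6, Complex.norm_real, Real.norm_of_nonneg h4.le]
  · have h1 : fderiv ℂ (fun z => μ (W.cDeformed z)) 0 = _ :=
      fderiv_comp 0 (hμ.differentiableAt (by norm_num))
        (hcd.differentiable (by norm_num)).differentiableAt
    rw [h1, ContinuousLinearMap.comp_apply, hder, inner_drift hW hσ.1 u]
    rfl

theorem measurable_pos (W : OQRW d 𝔥) (p : ℕ) : Measurable (W.pos p) :=
  measurable_subtype_coe.comp (measurable_pi_apply p)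

theorem charFun_map_pos {W : OQRW d 𝔥} (hW : W.DeformationsConverge) (ρ : W.DiagState)
    (m u : EuclideanSpace ℝ (Fin d)) (r : ℝ) (p : ℕ) :
    charFun ((W.law ρ).map fun ω => r • (W.pos p ω - (p : ℝ) • m)) u =
      Complex.exp (-(((⟪u, m⟫_ℝ : ℝ) : ℂ) * (Complex.I * r))) ^ p *
        opTrace ((W.cDeformed (Complex.I • toComplex (r • u)) ^ p) (W.fourierState ρ (r • u))) := by
  have hm : Measurable fun ω => r • (W.pos p ω - (p : ℝ) • m) :=
    ((W.measurable_pos p).sub_const _).const_smul r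
  rw [charFun_apply, integral_map hm.aemeasurable (by fun_prop), ← integral_phase_pos hW,
    ← integral_const_mul]
  congr 1
  funext ω
  rw [phase, ← Complex.exp_nat_mul, ← Complex.exp_add]
  congr 1
  rw [real_inner_comm, real_inner_smul_right, inner_sub_right, real_inner_smul_left,
    real_inner_smul_right]
  push_cast
  ring

theorem logLam_and_charFun_limit [Nontrivial 𝔥] {W : OQRW d 𝔥} (hW : W.DeformationsConverge)
    (hirr : IsIrreducibleMap W.aux) (ρ : W.DiagState) {σ : 𝔥 →L[ℂ] 𝔥}
    (hσ : IsInvariantState W.aux σ) :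
    ContDiffAt ℝ 2 W.lam 0 ∧ ContDiffAt ℝ 2 W.logLam 0 ∧
    (∀ u : EuclideanSpace ℝ (Fin d), iteratedDeriv 2 (fun t : ℝ => W.logLam (t • u)) 0 =
      iteratedDeriv 2 (fun t : ℝ => W.lam (t • u)) 0 -
        (deriv (fun t : ℝ => W.lam (t • u)) 0) ^ 2) ∧
    ∀ u : EuclideanSpace ℝ (Fin d), Tendsto (fun p : ℕ =>
      charFun ((W.law ρ).map fun ω => (√p)⁻¹ • (W.pos p ω - (p : ℝ) • W.drift σ)) u) atTop
      (𝓝 (Complex.exp (-(iteratedDeriv 2 (fun t : ℝ => W.logLam (t • u)) 0 : ℝ) / 2))) := by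
  obtain ⟨Λ, g, hΛ, hΛ0, hg, hg0, heig, hlam, hder⟩ := exists_perturbed_eigenvalue hW hirr hσ
  have hlam0 : W.lam 0 = 1 := by
    have h1 := hlam.self_of_nhds
    rw [map_zero, hΛ0] at h1
    exact_mod_cast h1
  have hc1 : ContDiffAt ℝ 2 W.lam 0 := by
    have h1 : ContDiffAt ℝ 2 (fun u : EuclideanSpace ℝ (Fin d) => (Λ (toComplex u)).re) 0 := by
      have h2 : ContDiffAt ℝ 2 Λ (toComplex (0 : EuclideanSpace ℝ (Fin d))) := by
        rw [map_zero]
        exact hΛ.restrict_scalars ℝ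
      exact Complex.reCLM.contDiff.contDiffAt.comp 0
        (h2.comp 0 (toComplex (d := d)).contDiff.contDiffAt)
    refine h1.congr_of_eventuallyEq (hlam.mono fun u hu => ?_)
    change W.lam u = (Λ (toComplex u)).re
    rw [← hu, Complex.ofReal_re]
  have hc2 : ContDiffAt ℝ 2 W.logLam 0 := hc1.log (by rw [hlam0]; exact one_ne_zero)
  have hline : ∀ u : EuclideanSpace ℝ (Fin d), ∃ h : ℂ → ℂ, (∀ z, h z = Λ (z • toComplex u)) ∧
      AnalyticAt ℂ h 0 ∧ h 0 = 1 ∧ deriv h 0 = ((⟪u, W.drift σ⟫_ℝ : ℝ) : ℂ) ∧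
      ∀ᶠ t : ℝ in 𝓝 0, ((W.lam (t • u) : ℝ) : ℂ) = h t := by
    intro u
    have hl : ∀ z : ℂ, HasDerivAt (fun z : ℂ => z • toComplex u) (toComplex u) z := fun z => by
      simpa using (hasDerivAt_id z).smul_const (toComplex u)
    have hlt : Tendsto (fun z : ℂ => z • toComplex u) (𝓝 0) (𝓝 0) := by
      simpa using (hl 0).continuousAt.tendsto
    have hlt' : Tendsto (fun t : ℝ => t • u) (𝓝 0) (𝓝 0) := by
      have : Continuous fun t : ℝ => t • u := by fun_prop
      simpa using this.tendsto 0
    refine ⟨fun z => Λ (z • toComplex u), fun _ => rfl, ?_, by simp [hΛ0], ?_, ?_⟩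
    -- Complex differentiability near `0` on a complex line already gives analyticity, so
    -- second-order Taylor expansion is available at imaginary points.
    · rw [Complex.analyticAt_iff_eventually_differentiableAt]
      filter_upwards [hlt.eventually (hΛ.eventually (by norm_num))] with z hz
      exact (hz.differentiableAt (by norm_num)).comp z (hl z).differentiableAt
    · have h1 : HasFDerivAt Λ (fderiv ℂ Λ 0) ((0 : ℂ) • toComplex u) := by
        rw [zero_smul]
        exact (hΛ.differentiableAt (by norm_num)).hasFDerivAt
      rw [← hder u]
      exact (h1.comp_hasDerivAt (0 : ℂ) (hl 0)).deriv
    · filter_upwards [hlt'.eventually hlam] with t ht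
      rw [ht, map_smul]
      rfl
  have hlog : ∀ u : EuclideanSpace ℝ (Fin d),
      iteratedDeriv 2 (fun t : ℝ => W.logLam (t • u)) 0 =
        iteratedDeriv 2 (fun t : ℝ => W.lam (t • u)) 0 -
          (deriv (fun t : ℝ => W.lam (t • u)) 0) ^ 2 := by
    intro u
    obtain ⟨h, _, hh, h0, _, hφ⟩ := hline u
    have h1 := eventually_deriv_ofReal hh hφ
    have h2 := eventually_deriv_ofReal hh.deriv (h1.mono fun t ht => ht.2)
    exact iteratedDeriv_two_log (by simp [hlam0]) (h1.mono fun t ht => ht.1) h2.self_of_nhds.1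
  refine ⟨hc1, hc2, hlog, fun u => ?_⟩
  obtain ⟨h, hhΛ, hh, h0, hd, hφ⟩ := hline u
  have h1 := eventually_deriv_ofReal hh hφ
  have h2 := eventually_deriv_ofReal hh.deriv (h1.mono fun t ht => ht.2)
  have e1 := h1.self_of_nhds.2
  have e2 := h2.self_of_nhds.2
  rw [Complex.ofReal_zero] at e1 e2
  have hlim := tendsto_pow_of_analyticAt hh h0
  rw [← e1, ← e2, ← Complex.ofReal_pow, ← Complex.ofReal_sub, ← iteratedDeriv_one,
    ← iteratedDeriv_succ, iteratedDeriv_one, ← hlog u, e1, hd] at hlim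
  have hr : Tendsto (fun p : ℕ => (√(p : ℝ))⁻¹) atTop (𝓝 0) :=
    tendsto_inv_atTop_zero.comp (Real.tendsto_sqrt_atTop.comp tendsto_natCast_atTop_atTop)
  have hθ : Tendsto (fun p : ℕ => (√(p : ℝ))⁻¹ • u) atTop (𝓝 0) := by
    simpa using hr.smul_const u
  have hz : Tendsto (fun p : ℕ => Complex.I • toComplex ((√(p : ℝ))⁻¹ • u)) atTop (𝓝 0) := by
    simpa using (((toComplex (d := d)).continuous.tendsto 0).comp hθ).const_smul Complex.I
  have hzz : ∀ p : ℕ, (Complex.I * ((√(p : ℝ))⁻¹ : ℝ)) • toComplex u =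
      Complex.I • toComplex ((√(p : ℝ))⁻¹ • u) := fun p => by
    rw [map_smul, mul_smul]
    rfl
  have hS : Tendsto (fun p : ℕ => W.fourierState ρ ((√(p : ℝ))⁻¹ • u)) atTop
      (𝓝 (W.fourierState ρ 0)) := ((W.continuous_fourierState ρ).tendsto 0).comp hθ
  have hgz : Tendsto (fun p : ℕ => g (Complex.I • toComplex ((√(p : ℝ))⁻¹ • u))) atTop
      (𝓝 opTraceL) := by
    rw [← hg0]
    exact hg.tendsto.comp hz
  have hmain : Tendsto (fun p : ℕ => g (Complex.I • toComplex ((√(p : ℝ))⁻¹ • u))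
      (W.fourierState ρ ((√(p : ℝ))⁻¹ • u))) atTop (𝓝 1) := by
    have h3 := ((isBoundedBilinearMap_apply (𝕜 := ℂ) (E := 𝔥 →L[ℂ] 𝔥) (F := ℂ)).continuous.tendsto
      (opTraceL, W.fourierState ρ 0)).comp (hgz.prodMk_nhds hS)
    rwa [opTraceL_apply, opTrace_fourierState_zero] at h3
  -- The error of replacing the trace by `g`: the prefactor has modulus one and the iterate has norm
  -- at most `1`, leaving `‖Tr - g‖ → 0`.
  have herr : Tendsto (fun p : ℕ =>
      Complex.exp (-(((⟪u, W.drift σ⟫_ℝ : ℝ) : ℂ) * (Complex.I * ((√(p : ℝ))⁻¹ : ℝ)))) ^ p *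
        ((opTraceL : (𝔥 →L[ℂ] 𝔥) →L[ℂ] ℂ) - g (Complex.I • toComplex ((√(p : ℝ))⁻¹ • u)))
          ((W.cDeformed (Complex.I • toComplex ((√(p : ℝ))⁻¹ • u)) ^ p)
            (W.fourierState ρ ((√(p : ℝ))⁻¹ • u)))) atTop (𝓝 0) := by
    have h3 := (hgz.const_sub opTraceL).norm
    rw [sub_self, norm_zero] at h3
    refine squeeze_zero_norm (fun p => ?_) h3
    rw [norm_mul, norm_pow, show -(((⟪u, W.drift σ⟫_ℝ : ℝ) : ℂ) *
      (Complex.I * ((√(p : ℝ))⁻¹ : ℝ))) =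
      ((-(⟪u, W.drift σ⟫_ℝ * (√(p : ℝ))⁻¹) : ℝ) : ℂ) * Complex.I by push_cast; ring,
      Complex.norm_exp_ofReal_mul_I, one_pow, one_mul]
    refine (ContinuousLinearMap.le_opNorm _ _).trans ?_
    exact mul_le_of_le_one_right (norm_nonneg _) (norm_cDeformed_pow_le hW ρ p _)
  have hsum := (hlim.mul hmain).add herr
  rw [mul_one, add_zero] at hsum
  refine hsum.congr' ?_
  filter_upwards [hz.eventually heig] with p hp
  rw [charFun_map_pos hW, hhΛ, hzz, mul_pow, mul_assoc,
    ← apply_pow_of_left_eigenvector _ _ _ hp, ← mul_add, sub_apply, opTraceL_apply]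
  ring


end OQRW

/-! ### The covariance matrix -/

namespace OQRW

variable {d : ℕ} {𝔥 : Type*} [NormedAddCommGroup 𝔥] [InnerProductSpace ℂ 𝔥]
  [CompleteSpace 𝔥] [FiniteDimensional ℂ 𝔥]

theorem covMatrix_isHermitian {W : OQRW d 𝔥} (h : ContDiffAt ℝ 2 W.logLam 0) :
    W.covMatrix.IsHermitian := by
  ext i j
  simp only [covMatrix, Matrix.conjTranspose_apply, Matrix.of_apply, iteratedFDeriv_two_apply,
    star_trivial]
  exact (h.isSymmSndFDerivAt (by simp)).eq _ _

theorem sum_covMatrix {W : OQRW d 𝔥} (h : ContDiffAt ℝ 2 W.logLam 0)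
    (u : EuclideanSpace ℝ (Fin d)) :
    ∑ i, ∑ j, u i * W.covMatrix i j * u j =
      iteratedDeriv 2 (fun t : ℝ => W.logLam (t • u)) 0 := by
  rw [iteratedDeriv_two_line h]
  have hu : u = ∑ i, u i • EuclideanSpace.single i (1 : ℝ) := by
    ext j
    simp [Finset.sum_apply, Pi.single_apply]
  conv_rhs => rw [hu]
  simp only [map_sum, map_smul, sum_apply, smul_apply, smul_eq_mul, covMatrix, Matrix.of_apply,
    iteratedFDeriv_two_apply, Matrix.cons_val_zero, Matrix.cons_val_one]
  rw [Finset.sum_comm]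
  refine Finset.sum_congr rfl fun i _ => ?_
  rw [Finset.mul_sum]
  refine Finset.sum_congr rfl fun j _ => ?_
  ring

theorem dotProduct_covMatrix (W : OQRW d 𝔥) (x : Fin d → ℝ) :
    x ⬝ᵥ W.covMatrix.mulVec x = ∑ i, ∑ j, x i * W.covMatrix i j * x j := by
  simp only [dotProduct, Matrix.mulVec, Finset.mul_sum, mul_assoc]

end OQRW

/-! ### The central limit theorem -/

theorem mainTheorem2 {d : ℕ} {𝔥 : Type*} [NormedAddCommGroup 𝔥] [InnerProductSpace ℂ 𝔥]
    [CompleteSpace 𝔥] [FiniteDimensional ℂ 𝔥] (W : OQRW d 𝔥) (hW : W.DeformationsConverge)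
    (hirr : IsIrreducibleMap W.aux) (ρ : W.DiagState) :
    ∃ ρinv : 𝔥 →L[ℂ] 𝔥,
      IsInvariantState W.aux ρinv ∧
      (∀ σ, IsInvariantState W.aux σ → σ = ρinv) ∧
      ContDiffAt ℝ 2 W.lam 0 ∧
      ContDiffAt ℝ 2 W.logLam 0 ∧
      (∀ u : EuclideanSpace ℝ (Fin d),
        ∑ i, ∑ j, u i * W.covMatrix i j * u j =
          iteratedDeriv 2 (fun t : ℝ => W.lam (t • u)) 0 -
            (deriv (fun t : ℝ => W.lam (t • u)) 0) ^ 2) ∧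
      W.covMatrix.PosSemidef ∧
      TendstoInDistribution
        (fun (p : ℕ) (ω : ℕ → W.V) =>
          (Real.sqrt p)⁻¹ • (W.pos p ω - (p : ℝ) • W.drift ρinv))
        atTop id (fun _ => W.law ρ) (multivariateGaussian 0 W.covMatrix) := by

  have := OQRW.nontrivial_of_diagState ρ
  have hA := OQRW.summable_norm_sq hW
  obtain ⟨σ, hσ⟩ := exists_isInvariantState W.aux (fun X hX => isPositive_krausMap hA hX)
    (opTrace_krausMap hA W.stochastic)
  obtain ⟨h1, h2, h3, h4⟩ := OQRW.logLam_and_charFun_limit hW hirr ρ hσ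
  have hmeas : ∀ p : ℕ, Measurable fun ω : ℕ → W.V =>
      (Real.sqrt p)⁻¹ • (W.pos p ω - (p : ℝ) • W.drift σ) := fun p =>
    ((W.measurable_pos p).sub_const ((p : ℝ) • W.drift σ)).const_smul (Real.sqrt p)⁻¹
  have hpsd : W.covMatrix.PosSemidef := by
    refine Matrix.PosSemidef.of_dotProduct_mulVec_nonneg (OQRW.covMatrix_isHermitian h2) fun x => ?_
    rw [star_trivial, OQRW.dotProduct_covMatrix]
    have h5 := OQRW.sum_covMatrix h2 (WithLp.toLp 2 x)
    have h6 := h4 (WithLp.toLp 2 x)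
    rw [← h5] at h6
    -- Characteristic functions are bounded by `1`, hence so is the limit `exp(-c / 2)`, where `c`
    -- is the Hessian form at `x`; this means `c ≥ 0`.
    have h7 := le_of_tendsto' h6.norm (b := 1) fun p => by
      have : IsProbabilityMeasure ((W.law ρ).map fun ω =>
          (Real.sqrt p)⁻¹ • (W.pos p ω - (p : ℝ) • W.drift σ)) :=
        Measure.isProbabilityMeasure_map (hmeas p).aemeasurable
      exact norm_charFun_le_one _
    rw [Complex.norm_exp, Real.exp_le_one_iff] at h7
    have h8 : ∀ c : ℝ, (-(c : ℂ) / 2).re = -c / 2 := fun c => by simp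
    rw [h8] at h7
    linarith
  refine ⟨σ, hσ, fun σ' hσ' => hσ.unique hA hirr hσ', h1, h2, fun u => ?_, hpsd, ?_⟩
  · rw [OQRW.sum_covMatrix h2, h3]
  · refine ⟨fun p => (hmeas p).aemeasurable, aemeasurable_id, ?_⟩
    refine ProbabilityMeasure.tendsto_of_tendsto_charFun fun u => ?_
    simp only [ProbabilityMeasure.coe_mk, Measure.map_id]
    rw [charFun_multivariateGaussian hpsd, OQRW.dotProduct_covMatrix, OQRW.sum_covMatrix h2]
    convert! h4 u using 2
    simp [neg_div]
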